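/- Let $\mathsf G$ be a connected reductive linear algebraic group over $\mathbb Q$, let $\mathbb A=\mathbb R\times\mathbb A^\infty$ be the adele ring of $\mathbb Q$, let $K_\infty$ be a maximal compact subgroup of $\mathsf G(\mathbb R)$ with identity component $K_\infty^\circ$, and put $\mathscr X:=\mathsf G(\mathbb Q)\backslash\mathsf G(\mathbb A)/K_\infty^\circ$ with its right action of $\mathsf G(\mathbb A)^\natural:=\mathsf G(\mathbb A)/\mathsf G(\mathbb A)^\circ=(K_\infty/K_\infty^\circ)\times\mathsf G(\mathbb A^\infty)$. *Supports.* Let $\Phi$ be a nonempty family of closed subsets of $\mathscr X$ that is stable under passing to closed subsets and under finite unions, and such that $Z.K\in\Phi$ for all $Z\in\Phi$ and all open compact subgroups $K$ of $\mathsf G(\mathbb A)^\natural$. *Neatness.* For $g\in \mathrm{GL}_n(\mathbb A^\infty)$ and a prime $\ell$, let $\mathrm n_\ell(g)$ be the number of torsion elements in the subgroup of $\overline{\mathbb Q}_\ell^\times$ generated by the eigenvalues of the $\ell$-component of $g$; $g$ is neat if no integer $d>1$ divides all $\mathrm n_\ell(g)$. An element of $\mathsf G(\mathbb A)^\natural$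 is neat if its finite part is neat under an embedding $\mathsf G\hookrightarrow\mathrm{GL}_n$, and a subgroup is neat if all its elements are. *Cohomology.* Let $R$ be a commutative ring. For a neat open compact subgroup $K$ of $\mathsf G(\mathbb A)^\natural$, let $S_K:=\mathscr X/K$, and let $\Phi/K$ be the family of closed subsets of $S_K$ whose preimage in $\mathscr X$ belongs to $\Phi$. For a subgroup $\mathbf G\supseteq K$ and an $R[\mathsf G(\mathbb Q)\times\mathbf G]$-module $M$, let $M_{[K]}$ be the local system $\mathsf G(\mathbb Q)\backslash((\mathsf G(\mathbb A)/K_\infty^\circ)\times M)/K$ on $S_K$, where $(\gamma,k)\in \mathsf G(\mathbb Q)\times K$ sends $(x,v)$ to $(\gamma xk,(\gamma,k^{-1}).v)$, and let $\mathrm H^i_\Phi(K,M):=\mathrm H^i_{\Phi/K}(S_K,M_{[K]})$ be the sheaf cohomology with supports in $\Phi/K$, $i\in\mathbb Z$. For $K'\subseteq K$ there are the pullback $\mathrm H^i_\Phi(K,M)\to\mathrm H^i_\Phi(K',M)$ and the push-forward $\mathrm H^i_\Phi(K',M)\to\mathrm H^i_\Phi(K,M)$ along the finite covering $S_{K'}\to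 S_K$. *Hecke homomorphisms.* Let $M$, $M'$ be modules over $R[\mathsf G(\mathbb Q)\times\mathbf G]$ and $R[\mathsf G(\mathbb Q)\times\mathbf G']$, and let $\phi:M\to M'$ be an $R[\mathsf G(\mathbb Q)]$-homomorphism. An element $t\in\mathsf G(\mathbb A)^\natural$ is $\phi$-adapted if $\phi(g.m)=(tgt^{-1}).\phi(m)$ for all $g\in\mathbf G\cap t^{-1}\mathbf G't$ and $m\in M$. If moreover $Z.t^{-1}\in\Phi$ for all $Z\in\Phi$, then for neat open compact subgroups $K\subseteq\mathbf G$ and $K'\subseteq\mathbf G'$ the Hecke homomorphism $\rho_{t,\phi}:\mathrm H^i_\Phi(K,M)\to\mathrm H^i_\Phi(K',M')$ is the composition $$\mathrm H^i_\Phi(K,M)\to\mathrm H^i_\Phi(K\cap t^{-1}K't,M)\to\mathrm H^i_\Phi(tKt^{-1}\cap K',M')\to\mathrm H^i_\Phi(K',M')$$ of the pullback, the map induced by $(x,u)\mapsto(xt^{-1},\phi(u))$, and the push-forward. **Proposition.** For $j=1,2,3$ let $K_j$ be a neat open compact subgroup of $\mathsf G(\mathbb A)^\natural$ and let $M_j$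 be an $R[\mathsf G(\mathbb Q)\times K_j]$-module. Let $s,t\in\mathsf G(\mathbb A)^\natural$, and let $\phi_1:M_1\to M_2$ and $\phi_2:M_2\to M_3$ be $R[\mathsf G(\mathbb Q)]$-homomorphisms such that $s$ is $\phi_1$-adapted, $t$ is $\phi_2$-adapted and $ts$ is $(\phi_2\circ\phi_1)$-adapted (with respect to the groups $K_j$). Suppose that $Z.s^{-1}\in\Phi$ and $Z.t^{-1}\in\Phi$ for all $Z\in\Phi$. If $$K_2=(sK_1s^{-1}\cap K_2)(K_2\cap t^{-1}K_3t),$$ then, for all $i\in\mathbb Z$, as homomorphisms $\mathrm H^i_\Phi(K_1,M_1)\to\mathrm H^i_\Phi(K_3,M_3)$, $$\rho_{t,\phi_2}\circ\rho_{s,\phi_1}=[sK_1s^{-1}\cap t^{-1}K_3t:sK_1s^{-1}\cap K_2\cap t^{-1}K_3t]\cdot\rho_{ts,\phi_2\circ\phi_1}.$$ -/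

import Mathlib

/-! ### Sheaf cohomology with supports, through the canonical (Godement) resolution -/

noncomputable section

namespace SupportCohomology

open CategoryTheory TopologicalSpace Opposite

universe u v

/-- A (nonempty) family of supports on a topological space: a family of closed subsets which is
stable under closed subsets and finite unions. -/
structure SupportFamily (X : Type*) [TopologicalSpace X] where
  sets : Set (Set X)
  isClosed : ∀ Z ∈ sets, IsClosed Z
  empty_mem : ∅ ∈ sets
  subset_mem : ∀ Z ∈ sets, ∀ Z', IsClosed Z' → Z' ⊆ Z → Z' ∈ sets
  union_mem : ∀ Z ∈ sets, ∀ Z' ∈ sets, Z ∪ Z' ∈ sets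

/-- Presheaves of `R`-modules on a topological space. -/
abbrev Psh (R : Type u) [CommRing R] (X : TopCat.{v}) := TopCat.Presheaf (ModuleCat.{v} R) X

variable {R : Type u} [CommRing R] {X Y : TopCat.{v}}

instance : Limits.PreservesFilteredColimits (forget (ModuleCat.{v} R)) where
  preserves_filtered_colimits J _ _ :=
    inferInstanceAs (Limits.PreservesColimitsOfShape J
      (forget₂ (ModuleCat.{v} R) AddCommGrpCat.{v} ⋙ forget AddCommGrpCat.{v}))

/-- The support of a global section: the set of points where its germ is nonzero. -/
def support (F : Psh R X) (s : F.obj (op ⊤)) : Set X := {x | F.Γgerm x s ≠ 0}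

theorem isClosed_support (F : Psh R X) (s : F.obj (op ⊤)) : IsClosed (support F s) := by
  rw [← isOpen_compl_iff, isOpen_iff_forall_mem_open]
  intro x hx
  have hx' : F.germ ⊤ x trivial s = F.germ ⊤ x trivial 0 := by
    rw [map_zero]
    simpa [support, TopCat.Presheaf.Γgerm] using hx
  obtain ⟨W, hxW, i, j, h⟩ := TopCat.Presheaf.germ_eq F x (U := ⊤) (V := ⊤) trivial trivial s 0 hx'
  refine ⟨W, ?_, W.2, hxW⟩
  intro y hy
  have h1 : F.Γgerm y s = F.germ W y hy (F.map i.op s) :=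
    (TopCat.Presheaf.Γgerm_res_apply F y hy s).symm
  have h2 : F.Γgerm y s = 0 := by rw [h1, h, map_zero, map_zero]
  simpa [support] using h2

/-- `Γ_Φ(X, F)`: the module of global sections of `F` whose support belongs to `Φ`. -/
def sectionsWithSupport (Φ : SupportFamily X) (F : Psh R X) : Submodule R (F.obj (op ⊤)) where
  carrier := {s | support F s ∈ Φ.sets}
  zero_mem' := by
    have : support F 0 = ∅ := by ext x; simp [support]
    simpa [this] using Φ.empty_mem
  add_mem' {a b} ha hb := by
    refine Φ.subset_mem _ (Φ.union_mem _ ha _ hb) _ (isClosed_support F _) fun x hx => ?_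
    by_contra h
    simp only [support, Set.mem_union, Set.mem_ofPred_eq, not_or, not_not] at h
    exact hx (by rw [map_add, h.1, h.2, add_zero])
  smul_mem' r a ha := by
    refine Φ.subset_mem _ ha _ (isClosed_support F _) fun x hx h => hx ?_
    rw [map_smul, h, smul_zero]

/-- The map on stalks `F_{f y} ⟶ G_y` induced by a morphism `F ⟶ f_* G`. -/
def stalkMap (f : Y ⟶ X) {F : Psh R X} {G : Psh R Y}
    (k : F ⟶ (TopCat.Presheaf.pushforward _ f).obj G) (y : Y) : F.stalk (f y) ⟶ G.stalk y :=
  (TopCat.Presheaf.stalkFunctor _ (f y)).map k ≫ TopCat.Presheaf.stalkPushforward _ f G y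

theorem stalkMap_germ (f : Y ⟶ X) {F : Psh R X} {G : Psh R Y}
    (k : F ⟶ (TopCat.Presheaf.pushforward _ f).obj G) (U : Opens X) (y : Y) (hy : f y ∈ U)
    (s : F.obj (op U)) :
    stalkMap f k y (F.germ U (f y) hy s) =
      G.germ ((Opens.map f).obj U) y hy (k.app (op U) s) := by
  refine Eq.trans (congrArg (TopCat.Presheaf.stalkPushforward _ f G y)
    (TopCat.Presheaf.stalkFunctor_map_germ_apply U (f y) hy k s)) ?_
  exact congrArg (fun m => m (k.app (op U) s)) (TopCat.Presheaf.stalkPushforward_germ _ f G U y hy)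

/-- The map `Γ_Φ(X, F) ⟶ Γ_Φ'(Y, G)` induced by a continuous map `f : Y ⟶ X` and a morphism
`F ⟶ f_* G`, when preimages of members of `Φ` belong to `Φ'`. -/
def sectionsMap {Φ : SupportFamily X} {Φ' : SupportFamily Y} (f : Y ⟶ X)
    (hf : ∀ Z ∈ Φ.sets, f ⁻¹' Z ∈ Φ'.sets) {F : Psh R X} {G : Psh R Y}
    (k : F ⟶ (TopCat.Presheaf.pushforward _ f).obj G) :
    ModuleCat.of R (sectionsWithSupport Φ F) ⟶ ModuleCat.of R (sectionsWithSupport Φ' G) :=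
  ModuleCat.ofHom <| LinearMap.restrict (k.app (op ⊤)).hom fun s hs =>
    Φ'.subset_mem _ (hf _ hs) _ (isClosed_support G _) fun y hy h => hy <| by
      have h1 := stalkMap_germ f k ⊤ y trivial s
      have h2 : F.germ ⊤ (f y) trivial s = 0 := by
        simpa [support, TopCat.Presheaf.Γgerm] using h
      rw [h2, map_zero] at h1
      exact h1.symm

/-- The sheaf `C⁰(F)` of not necessarily continuous sections of the étalé space of `F`:
`C⁰(F)(U) = ∏_{x ∈ U} F_x`. -/
def godement (F : Psh R X) : Psh R X where
  obj U := ModuleCat.of R (∀ x : U.unop, F.stalk x.1)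
  map i := ModuleCat.ofHom
    { toFun := fun s x => s ⟨x.1, i.unop.le x.2⟩
      map_add' := fun _ _ => rfl
      map_smul' := fun _ _ => rfl }
  map_id _ := rfl
  map_comp _ _ := rfl

/-- The canonical map `F ⟶ C⁰(F)`. -/
def toGodement (F : Psh R X) : F ⟶ godement F where
  app U := ModuleCat.ofHom (LinearMap.pi fun x : U.unop => (F.germ U.unop x.1 x.2).hom)
  naturality U V i := by
    ext s
    funext x
    exact TopCat.Presheaf.germ_res_apply' F i x.1 x.2 s

/-- The presheaf cokernel of `F ⟶ C⁰(F)`. -/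
def godementCoker (F : Psh R X) : Psh R X where
  obj U := ModuleCat.of R ((godement F).obj U ⧸ LinearMap.range ((toGodement F).app U).hom)
  map {U V} i := ModuleCat.ofHom <| Submodule.mapQ _ _ ((godement F).map i).hom <| by
    rintro _ ⟨s, rfl⟩
    exact ⟨F.map i s, congrArg (fun m => m s) ((toGodement F).naturality i)⟩
  map_id _ := ModuleCat.hom_ext (Submodule.linearMap_qext _ rfl)
  map_comp _ _ := ModuleCat.hom_ext (Submodule.linearMap_qext _ rfl)

/-- The projection `C⁰(F) ⟶ C⁰(F) / F`. -/
def toCoker (F : Psh R X) : godement F ⟶ godementCoker F where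
  app _ := ModuleCat.ofHom (Submodule.mkQ _)
  naturality _ _ _ := rfl

theorem toGodement_toCoker (F : Psh R X) : toGodement F ≫ toCoker F = 0 := by
  ext U s
  exact (Submodule.Quotient.mk_eq_zero _).2 ⟨s, rfl⟩

/-- Functoriality of `C⁰`: a morphism `F ⟶ f_* G` induces `C⁰(F) ⟶ f_* C⁰(G)`. -/
def godementMap (f : Y ⟶ X) {F : Psh R X} {G : Psh R Y}
    (k : F ⟶ (TopCat.Presheaf.pushforward _ f).obj G) :
    godement F ⟶ (TopCat.Presheaf.pushforward _ f).obj (godement G) where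
  app U := ModuleCat.ofHom <|
    { toFun := fun (s : ∀ x : U.unop, F.stalk x.1) (y : (Opens.map f).obj U.unop) =>
        stalkMap f k y.1 (s ⟨f y.1, y.2⟩)
      map_add' := fun _ _ => funext fun _ => map_add _ _ _
      map_smul' := fun _ _ => funext fun _ => map_smul _ _ _ }
  naturality _ _ _ := rfl

theorem toGodement_map (f : Y ⟶ X) {F : Psh R X} {G : Psh R Y}
    (k : F ⟶ (TopCat.Presheaf.pushforward _ f).obj G) :
    toGodement F ≫ godementMap f k =
      k ≫ (TopCat.Presheaf.pushforward _ f).map (toGodement G) := by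
  ext U s
  funext y
  exact stalkMap_germ f k U y.1 y.2 s

/-- Functoriality of `C⁰(F) / F`. -/
def cokerMap (f : Y ⟶ X) {F : Psh R X} {G : Psh R Y}
    (k : F ⟶ (TopCat.Presheaf.pushforward _ f).obj G) :
    godementCoker F ⟶ (TopCat.Presheaf.pushforward _ f).obj (godementCoker G) where
  app U := ModuleCat.ofHom <| Submodule.mapQ _ _ ((godementMap f k).app U).hom <| by
    rintro _ ⟨s, rfl⟩
    exact ⟨k.app U s, (congrArg (fun m => m.app U s) (toGodement_map f k)).symm⟩
  naturality _ _ _ := ModuleCat.hom_ext (Submodule.linearMap_qext _ rfl)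

theorem toCoker_map (f : Y ⟶ X) {F : Psh R X} {G : Psh R Y}
    (k : F ⟶ (TopCat.Presheaf.pushforward _ f).obj G) :
    toCoker F ≫ cokerMap f k =
      godementMap f k ≫ (TopCat.Presheaf.pushforward _ f).map (toCoker G) := rfl

/-- The differential `C⁰(F) ⟶ C⁰(C⁰(F) / F)`. -/
def godementD (F : Psh R X) : godement F ⟶ godement (godementCoker F) :=
  toCoker F ≫ toGodement (godementCoker F)

theorem godementD_comp (F : Psh R X) : godementD F ≫ godementD (godementCoker F) = 0 := by
  rw [godementD, godementD, Category.assoc, ← Category.assoc (toGodement _), toGodement_toCoker,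
    Limits.zero_comp, Limits.comp_zero]

theorem godementD_map (f : Y ⟶ X) {F : Psh R X} {G : Psh R Y}
    (k : F ⟶ (TopCat.Presheaf.pushforward _ f).obj G) :
    godementD F ≫ godementMap f (cokerMap f k) =
      godementMap f k ≫ (TopCat.Presheaf.pushforward _ f).map (godementD G) := by
  rw [godementD, godementD, Category.assoc, toGodement_map, ← Category.assoc, toCoker_map]
  rfl

/-- The iterated cokernels: `P⁰ = F` and `Pⁿ⁺¹ = C⁰(Pⁿ) / Pⁿ`. The canonical resolution of `F` has
the terms `Cⁿ(F) = C⁰(Pⁿ)`; these only depend on the stalks of `Pⁿ`, so that it is not necessary to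
sheafify the cokernels. -/
def iterCoker (F : Psh R X) : ℕ → Psh R X
  | 0 => F
  | n + 1 => godementCoker (iterCoker F n)

/-- Functoriality of the iterated cokernels. -/
def iterCokerMap (f : Y ⟶ X) {F : Psh R X} {G : Psh R Y}
    (k : F ⟶ (TopCat.Presheaf.pushforward _ f).obj G) :
    ∀ n, iterCoker F n ⟶ (TopCat.Presheaf.pushforward _ f).obj (iterCoker G n)
  | 0 => k
  | n + 1 => cokerMap f (iterCokerMap f k n)

/-- The differential `Γ_Φ(X, Cⁿ(F)) ⟶ Γ_Φ(X, Cⁿ⁺¹(F))`. -/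
def sectionsD (Φ : SupportFamily X) (F : Psh R X) (n : ℕ) :
    ModuleCat.of R (sectionsWithSupport Φ (godement (iterCoker F n))) ⟶
      ModuleCat.of R (sectionsWithSupport Φ (godement (iterCoker F (n + 1)))) :=
  sectionsMap (𝟙 X) (fun _ hZ => hZ) (godementD (iterCoker F n))

/-- The complex `Γ_Φ(X, C^•(F))`. -/
def cochains (Φ : SupportFamily X) (F : Psh R X) : CochainComplex (ModuleCat.{v} R) ℕ :=
  CochainComplex.of (fun n => ModuleCat.of R (sectionsWithSupport Φ (godement (iterCoker F n))))
    (sectionsD Φ F)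
    (fun n => ModuleCat.hom_ext <| LinearMap.ext fun s => Subtype.ext <|
      congrArg (fun m => m.app (op ⊤) s.1) (godementD_comp (iterCoker F n)))

theorem cochains_d (Φ : SupportFamily X) (F : Psh R X) (n : ℕ) :
    (cochains Φ F).d n (n + 1) =
      sectionsD Φ F n :=
  CochainComplex.of_d (fun n => ModuleCat.of R (sectionsWithSupport Φ (godement (iterCoker F n))))
    (sectionsD Φ F) n

/-- The map of complexes induced by `f : Y ⟶ X` and a morphism `F ⟶ f_* G`. -/
def cochainsMap {Φ : SupportFamily X} {Φ' : SupportFamily Y} (f : Y ⟶ X)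
    (hf : ∀ Z ∈ Φ.sets, f ⁻¹' Z ∈ Φ'.sets) {F : Psh R X} {G : Psh R Y}
    (k : F ⟶ (TopCat.Presheaf.pushforward _ f).obj G) : cochains Φ F ⟶ cochains Φ' G :=
  CochainComplex.ofHom (fun n => sectionsMap f hf (godementMap f (iterCokerMap f k n)))
    (fun n => by
      have h : sectionsMap f hf (godementMap f (iterCokerMap f k n)) ≫
          sectionsD Φ' G n = sectionsD Φ F n ≫
            sectionsMap f hf (godementMap f (iterCokerMap f k (n + 1))) :=
        ModuleCat.hom_ext <| LinearMap.ext fun s => Subtype.ext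
          (congrArg (fun m => m.app (op ⊤) s.1) (godementD_map f (iterCokerMap f k n))).symm
      exact (congrArg (fun m => sectionsMap f hf (godementMap f (iterCokerMap f k n)) ≫ m)
        (cochains_d Φ' G n)).trans (h.trans (congrArg (fun m => m ≫
          sectionsMap f hf (godementMap f (iterCokerMap f k (n + 1)))) (cochains_d Φ F n)).symm))

/-- The cohomology `H^i_Φ(X, F)` with supports in `Φ`: the cohomology of the global sections with
support in `Φ` of the canonical resolution of `F` (the complex is extended by zero to negative
degrees). -/
def cohomology (Φ : SupportFamily X) (F : Psh R X) (i : ℤ) : ModuleCat.{v} R :=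
  ((ComplexShape.embeddingUpNat.extendFunctor (ModuleCat.{v} R)).obj (cochains Φ F)).homology i

/-- The map `H^i_Φ(X, F) ⟶ H^i_Φ'(Y, G)` induced by `f : Y ⟶ X` and a morphism `F ⟶ f_* G`. -/
def cohomologyMap {Φ : SupportFamily X} {Φ' : SupportFamily Y} (f : Y ⟶ X)
    (hf : ∀ Z ∈ Φ.sets, f ⁻¹' Z ∈ Φ'.sets) {F : Psh R X} {G : Psh R Y}
    (k : F ⟶ (TopCat.Presheaf.pushforward _ f).obj G) (i : ℤ) :
    cohomology Φ F i ⟶ cohomology Φ' G i :=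
  HomologicalComplex.homologyMap
    ((ComplexShape.embeddingUpNat.extendFunctor (ModuleCat.{v} R)).map (cochainsMap f hf k)) i

/-- The push-forward `H^i_Φ'(Y, G) ⟶ H^i_Φ(X, F)` along a finite covering map `f : Y ⟶ X` induced by
a morphism (a trace) `f_* G ⟶ F`: the inverse of the canonical isomorphism
`H^i_Φ(X, f_* G) ≅ H^i_Φ'(Y, G)`, followed by the map induced by the trace.
(For a general `f`, where the canonical map need not be invertible, the value is `0`.) -/
def cohomologyPush {Φ : SupportFamily X} {Φ' : SupportFamily Y} (f : Y ⟶ X)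
    (hf : ∀ Z ∈ Φ.sets, f ⁻¹' Z ∈ Φ'.sets) {F : Psh R X} {G : Psh R Y}
    (tr : (TopCat.Presheaf.pushforward _ f).obj G ⟶ F) (i : ℤ) :
    cohomology Φ' G i ⟶ cohomology Φ F i :=
  open Classical in
  if _h : IsIso (cohomologyMap (Φ := Φ) (Φ' := Φ') f hf
      (𝟙 ((TopCat.Presheaf.pushforward _ f).obj G)) i) then
    CategoryTheory.inv (cohomologyMap (Φ := Φ) (Φ' := Φ') f hf
      (𝟙 ((TopCat.Presheaf.pushforward _ f).obj G)) i) ≫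
        cohomologyMap (Φ := Φ) (Φ' := Φ) (𝟙 X) (fun _ hZ => hZ)
          (tr ≫ (TopCat.Presheaf.Pushforward.id F).inv) i
  else 0

end SupportCohomology

end

/-! ### Linear algebraic groups over `ℚ`, their adelic points, and neatness -/

noncomputable section

namespace AdelicGroup

open IsDedekindDomain

/-- The ring `𝔸^∞` of finite adeles of `ℚ`. -/
abbrev FinAdele : Type := FiniteAdeleRing ℤ ℚ

/-- Polynomials in the matrix coefficients. -/
abbrev MatPoly (n : ℕ) (k : Type) [CommRing k] := MvPolynomial (Fin n × Fin n) k

/-- The common zeros in `GL_n(B)` of polynomials in the matrix coefficients over `k`. -/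
def zeros {n : ℕ} {k : Type} [CommRing k] (S : Set (MatPoly n k)) (B : Type) [CommRing B]
    [Algebra k B] : Set (GL (Fin n) B) :=
  {g | ∀ P ∈ S, MvPolynomial.aeval (fun ij : Fin n × Fin n => g.1 ij.1 ij.2) P = 0}

/-- A linear algebraic group over `ℚ`: a closed subgroup scheme of `GL_n`, given by a set of
equations whose solutions form a subgroup of `GL_n(B)` for every commutative `ℚ`-algebra `B`. -/
structure LinearAlgebraicGroup (n : ℕ) where
  eqs : Set (MatPoly n ℚ)
  one_mem : ∀ (B : Type) [CommRing B] [Algebra ℚ B], 1 ∈ zeros eqs B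
  mul_mem : ∀ (B : Type) [CommRing B] [Algebra ℚ B] (g h : GL (Fin n) B),
    g ∈ zeros eqs B → h ∈ zeros eqs B → g * h ∈ zeros eqs B
  inv_mem : ∀ (B : Type) [CommRing B] [Algebra ℚ B] (g : GL (Fin n) B),
    g ∈ zeros eqs B → g⁻¹ ∈ zeros eqs B

namespace LinearAlgebraicGroup

variable {n : ℕ} (G : LinearAlgebraicGroup n)

/-- The group `G(B)` of `B`-valued points. -/
def points (B : Type) [CommRing B] [Algebra ℚ B] : Subgroup (GL (Fin n) B) where
  carrier := zeros G.eqs B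
  one_mem' := G.one_mem B
  mul_mem' := G.mul_mem B _ _
  inv_mem' := G.inv_mem B _

/-- The homomorphism `G(ℚ) → G(B)`. -/
def rationalPoints (B : Type) [CommRing B] [Algebra ℚ B] : G.points ℚ →* G.points B :=
  ((Matrix.GeneralLinearGroup.map (algebraMap ℚ B)).comp (G.points ℚ).subtype).codRestrict _ <| by
    intro g P hP
    have h := congrArg (algebraMap ℚ B) (g.2 P hP)
    rw [map_zero, ← MvPolynomial.aeval_algebraMap_apply] at h
    exact h

end LinearAlgebraicGroup

/-- Zariski closed subsets of `GL_n(k)`. -/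
def IsZariskiClosed {n : ℕ} {k : Type} [Field k] (Z : Set (GL (Fin n) k)) : Prop :=
  ∃ S : Set (MatPoly n k), Z = zeros S k

/-- Connectedness of a subgroup of `GL_n(k)` for the Zariski topology. -/
def IsZariskiConnected {n : ℕ} {k : Type} [Field k] (H : Subgroup (GL (Fin n) k)) : Prop :=
  ∀ Z Z' : Set (GL (Fin n) k), IsZariskiClosed Z → IsZariskiClosed Z' →
    (H : Set (GL (Fin n) k)) ⊆ Z ∪ Z' → (H : Set (GL (Fin n) k)) ∩ (Z ∩ Z') = ∅ →
    (H : Set (GL (Fin n) k)) ⊆ Z ∨ (H : Set (GL (Fin n) k)) ⊆ Z'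

/-- `G` is connected and reductive: `G(ℚ̄)` is connected, and its unipotent radical is trivial, that
is, it has no nontrivial connected closed normal subgroup consisting of unipotent elements. -/
def LinearAlgebraicGroup.IsConnectedReductive {n : ℕ} (G : LinearAlgebraicGroup n) : Prop :=
  IsZariskiConnected (G.points (AlgebraicClosure ℚ)) ∧
  ∀ N : Subgroup (GL (Fin n) (AlgebraicClosure ℚ)), N ≤ G.points (AlgebraicClosure ℚ) →
    (∀ g ∈ G.points (AlgebraicClosure ℚ), ∀ u ∈ N, g * u * g⁻¹ ∈ N) →
    IsZariskiClosed (N : Set (GL (Fin n) (AlgebraicClosure ℚ))) → IsZariskiConnected N →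
    (∀ u ∈ N, IsNilpotent (u.1 - 1)) → N = ⊥

/-- The component at a finite place of an element of `GL_n(𝔸^∞)`, as a matrix over an algebraic
closure of the completion. -/
def localMatrix {n : ℕ} (g : GL (Fin n) FinAdele) (v : HeightOneSpectrum ℤ) :
    Matrix (Fin n) (Fin n) (AlgebraicClosure (v.adicCompletion ℚ)) :=
  g.1.map fun a : FinAdele => algebraMap (v.adicCompletion ℚ) _ (a v)

/-- The group generated by the eigenvalues of the component of `g` at `v`. -/
def eigenvalueGroup {n : ℕ} (g : GL (Fin n) FinAdele) (v : HeightOneSpectrum ℤ) :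
    Subgroup (AlgebraicClosure (v.adicCompletion ℚ))ˣ :=
  Subgroup.closure {μ | Module.End.HasEigenvalue (Matrix.toLin' (localMatrix g v)) μ.1}

/-- The number of torsion elements in the group generated by the eigenvalues at `v`. -/
def torsionNumber {n : ℕ} (g : GL (Fin n) FinAdele) (v : HeightOneSpectrum ℤ) : ℕ :=
  Nat.card (CommGroup.torsion (eigenvalueGroup g v))

/-- Neat elements of `GL_n(𝔸^∞)`. -/
def IsNeat {n : ℕ} (g : GL (Fin n) FinAdele) : Prop :=
  {d : ℕ | 1 ≤ d ∧ ∀ v, d ∣ torsionNumber g v} = {1}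

/-! ### The group `G(𝔸)^♮` and the space `𝒳 = G(ℚ) \ G(𝔸) / K_∞°` -/

/-- The identity component of a topological group is normal. -/
instance identityComponent_normal (H : Type*) [TopologicalSpace H] [Group H]
    [IsTopologicalGroup H] : (Subgroup.connectedComponentOfOne H).Normal where
  conj_mem a ha g := by
    have hc : Continuous fun x : H => g * x * g⁻¹ := by fun_prop
    have h := hc.image_connectedComponent_subset 1 (Set.mem_image_of_mem _ ha)
    rw [mul_one, mul_inv_cancel] at h
    exact h

variable {n : ℕ} (G : LinearAlgebraicGroup n) (Kinf : Subgroup (G.points ℝ))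

/-- The group `G(𝔸)^♮ = G(ℝ)^♮ × G(𝔸^∞)`, where `G(ℝ)^♮` is identified with `K_∞^♮ = K_∞ / K_∞°`. -/
abbrev AdelicNat : Type := (Kinf ⧸ Subgroup.connectedComponentOfOne Kinf) × G.points FinAdele

/-- The space `G(𝔸) / K_∞° = G(ℝ) / K_∞° × G(𝔸^∞)`. -/
abbrev AdelicCoset : Type :=
  (G.points ℝ ⧸ (Subgroup.connectedComponentOfOne Kinf).map Kinf.subtype) × G.points FinAdele

variable {G Kinf}

/-- The right action of `K_∞ / K_∞°` on `G(ℝ) / K_∞°`. -/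
def infMul (x : G.points ℝ ⧸ (Subgroup.connectedComponentOfOne Kinf).map Kinf.subtype)
    (k : Kinf ⧸ Subgroup.connectedComponentOfOne Kinf) :
    G.points ℝ ⧸ (Subgroup.connectedComponentOfOne Kinf).map Kinf.subtype :=
  Quotient.liftOn₂' x k (fun a b => QuotientGroup.mk (a * (b : G.points ℝ))) <| by
    intro a b a' b' ha hb
    rw [QuotientGroup.leftRel_apply] at ha hb
    obtain ⟨c, hc, hc'⟩ := ha
    refine QuotientGroup.eq.2 ⟨b⁻¹ * c * b * (b⁻¹ * b'), ?_, ?_⟩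
    · refine mul_mem ?_ hb
      have := Subgroup.Normal.conj_mem (identityComponent_normal Kinf) c hc b⁻¹
      simpa using this
    · have h2 : (c : G.points ℝ) = a⁻¹ * a' := hc'
      simp only [Subgroup.subtype_apply, Subgroup.coe_mul, Subgroup.coe_inv, h2]
      group

theorem infMul_one (x : G.points ℝ ⧸ (Subgroup.connectedComponentOfOne Kinf).map Kinf.subtype) :
    infMul x 1 = x := by
  induction x using QuotientGroup.induction_on with
  | H a => exact congrArg QuotientGroup.mk (mul_one a)

theorem infMul_mul (x : G.points ℝ ⧸ (Subgroup.connectedComponentOfOne Kinf).map Kinf.subtype)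
    (k l : Kinf ⧸ Subgroup.connectedComponentOfOne Kinf) :
    infMul x (k * l) = infMul (infMul x k) l := by
  induction x using QuotientGroup.induction_on with
  | H a =>
    induction k using QuotientGroup.induction_on with
    | H b =>
      induction l using QuotientGroup.induction_on with
      | H c => exact congrArg QuotientGroup.mk (mul_assoc a b c).symm

theorem smul_infMul (g : G.points ℝ)
    (x : G.points ℝ ⧸ (Subgroup.connectedComponentOfOne Kinf).map Kinf.subtype)
    (k : Kinf ⧸ Subgroup.connectedComponentOfOne Kinf) :
    g • infMul x k = infMul (g • x) k := by
  induction x using QuotientGroup.induction_on with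
  | H a =>
    induction k using QuotientGroup.induction_on with
    | H b => exact congrArg QuotientGroup.mk (mul_assoc g a b).symm

theorem continuous_infMul (k : Kinf ⧸ Subgroup.connectedComponentOfOne Kinf) :
    Continuous fun x : G.points ℝ ⧸ (Subgroup.connectedComponentOfOne Kinf).map Kinf.subtype =>
      infMul x k := by
  induction k using QuotientGroup.induction_on with
  | H b =>
    refine continuous_quot_lift _ ?_
    exact continuous_quotient_mk'.comp (continuous_id.mul continuous_const)

namespace AdelicCoset

/-- The right action of `G(𝔸)^♮` on `G(𝔸) / K_∞°`. -/
def mul (y : AdelicCoset G Kinf) (g : AdelicNat G Kinf) : AdelicCoset G Kinf :=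
  (infMul y.1 g.1, y.2 * g.2)

/-- The left action of `G(ℚ)` on `G(𝔸) / K_∞°`. -/
def act (γ : G.points ℚ) (y : AdelicCoset G Kinf) : AdelicCoset G Kinf :=
  (G.rationalPoints ℝ γ • y.1, G.rationalPoints FinAdele γ * y.2)

theorem mul_one' (y : AdelicCoset G Kinf) : mul y 1 = y :=
  Prod.ext (infMul_one _) (mul_one _)

theorem mul_mul' (y : AdelicCoset G Kinf) (g h : AdelicNat G Kinf) :
    mul y (g * h) = mul (mul y g) h :=
  Prod.ext (infMul_mul _ _ _) (mul_assoc _ _ _).symm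

theorem act_mul (γ : G.points ℚ) (y : AdelicCoset G Kinf) (g : AdelicNat G Kinf) :
    act γ (mul y g) = mul (act γ y) g :=
  Prod.ext (smul_infMul _ _ _) (mul_assoc _ _ _).symm

theorem act_one (y : AdelicCoset G Kinf) : act 1 y = y := by
  simp [act]

theorem act_act (γ δ : G.points ℚ) (y : AdelicCoset G Kinf) :
    act (γ * δ) y = act γ (act δ y) := by
  simp [act, mul_smul, mul_assoc]

theorem continuous_mul (g : AdelicNat G Kinf) :
    Continuous fun y : AdelicCoset G Kinf => mul y g :=
  ((continuous_infMul g.1).comp continuous_fst).prodMk (continuous_snd.mul continuous_const)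

end AdelicCoset

variable (G Kinf)

/-- The orbit relation of `G(ℚ)` on `G(𝔸) / K_∞°`. -/
def rationalSetoid : Setoid (AdelicCoset G Kinf) where
  r y y' := ∃ γ : G.points ℚ, AdelicCoset.act γ y = y'
  iseqv :=
    { refl := fun y => ⟨1, AdelicCoset.act_one y⟩
      symm := by
        rintro y _ ⟨γ, rfl⟩
        exact ⟨γ⁻¹, by rw [← AdelicCoset.act_act, inv_mul_cancel, AdelicCoset.act_one]⟩
      trans := by
        rintro y _ _ ⟨γ, rfl⟩ ⟨δ, rfl⟩
        exact ⟨δ * γ, AdelicCoset.act_act _ _ _⟩ }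

/-- The space `𝒳 = G(ℚ) \ G(𝔸) / K_∞°`, with the quotient topology. -/
abbrev AdelicSpace : Type := Quotient (rationalSetoid G Kinf)

variable {G Kinf}

namespace AdelicSpace

/-- The right action of `G(𝔸)^♮` on `𝒳`. -/
def mul (x : AdelicSpace G Kinf) (g : AdelicNat G Kinf) : AdelicSpace G Kinf :=
  Quotient.map (sa := rationalSetoid G Kinf) (sb := rationalSetoid G Kinf)
    (fun y => AdelicCoset.mul y g)
    (by rintro y _ ⟨γ, rfl⟩; exact ⟨γ, AdelicCoset.act_mul _ _ _⟩) x

theorem mul_one' (x : AdelicSpace G Kinf) : mul x 1 = x := by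
  induction x using Quotient.inductionOn with
  | h y => exact congrArg (Quotient.mk _) (AdelicCoset.mul_one' y)

theorem mul_mul' (x : AdelicSpace G Kinf) (g h : AdelicNat G Kinf) :
    mul x (g * h) = mul (mul x g) h := by
  induction x using Quotient.inductionOn with
  | h y => exact congrArg (Quotient.mk _) (AdelicCoset.mul_mul' y g h)

theorem continuous_mul (g : AdelicNat G Kinf) :
    Continuous fun x : AdelicSpace G Kinf => mul x g :=
  continuous_quot_lift _ (continuous_quotient_mk'.comp (AdelicCoset.continuous_mul g))

end AdelicSpace

variable (G Kinf)

/-- Open compact subgroups of `G(𝔸)^♮`. -/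
structure Level where
  toSubgroup : Subgroup (AdelicNat G Kinf)
  isOpen : IsOpen (toSubgroup : Set (AdelicNat G Kinf))
  isCompact : IsCompact (toSubgroup : Set (AdelicNat G Kinf))

variable {G Kinf}

namespace Level

/-- A subgroup of `G(𝔸)^♮` is neat if (the finite adelic parts of) all its elements are neat. -/
def Neat (K : Level G Kinf) : Prop :=
  ∀ g ∈ K.toSubgroup, IsNeat (g.2 : GL (Fin n) FinAdele)

/-- The intersection `K ∩ K'`. -/
def inter (K K' : Level G Kinf) : Level G Kinf where
  toSubgroup := K.toSubgroup ⊓ K'.toSubgroup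
  isOpen := K.isOpen.inter K'.isOpen
  isCompact := K.isCompact.inter_right (Subgroup.isClosed_of_isOpen _ K'.isOpen)

/-- The conjugate `t K t⁻¹`. -/
def conj (t : AdelicNat G Kinf) (K : Level G Kinf) : Level G Kinf where
  toSubgroup := K.toSubgroup.map (MulAut.conj t).toMonoidHom
  isOpen := by
    have : ((K.toSubgroup.map (MulAut.conj t).toMonoidHom : Subgroup (AdelicNat G Kinf)) :
        Set (AdelicNat G Kinf)) = (fun x => t⁻¹ * x * t) ⁻¹' K.toSubgroup := by
      ext x
      constructor
      · rintro ⟨k, hk, rfl⟩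
        simpa [mul_assoc] using hk
      · intro hx
        exact ⟨_, hx, by simp [mul_assoc]⟩
    rw [this]
    exact K.isOpen.preimage (by fun_prop)
  isCompact := by
    have h : Continuous fun x : AdelicNat G Kinf => t * x * t⁻¹ := by fun_prop
    exact K.isCompact.image h

theorem mem_conj {t : AdelicNat G Kinf} {K : Level G Kinf} {g : AdelicNat G Kinf} :
    g ∈ (K.conj t).toSubgroup ↔ t⁻¹ * g * t ∈ K.toSubgroup := by
  constructor
  · rintro ⟨k, hk, rfl⟩
    simpa [mul_assoc] using hk
  · intro hx
    exact ⟨_, hx, by simp [mul_assoc]⟩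

/-- A level has finite index in any larger level. -/
instance finite_quotient (K K' : Level G Kinf) :
    Finite (K.toSubgroup ⧸ K'.toSubgroup.subgroupOf K.toSubgroup) := by
  have : CompactSpace K.toSubgroup := isCompact_iff_compactSpace.1 K.isCompact
  exact Subgroup.quotient_finite_of_isOpen _ (K'.isOpen.preimage continuous_subtype_val)

instance fintype_quotient (K K' : Level G Kinf) :
    Fintype (K.toSubgroup ⧸ K'.toSubgroup.subgroupOf K.toSubgroup) := Fintype.ofFinite _

end Level

end AdelicGroup

end

/-! ### Cohomology of the quotients `𝒳 / K`, and Hecke homomorphisms -/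

noncomputable section

namespace AdelicGroup

open CategoryTheory TopologicalSpace Opposite SupportCohomology

universe u v

variable {n : ℕ} {G : LinearAlgebraicGroup n} {Kinf : Subgroup (G.points ℝ)}

variable (G Kinf) in
/-- A support condition on `𝒳`: a family of supports such that `Z.K` belongs to it for every member
`Z` and every open compact subgroup `K` of `G(𝔸)^♮`. -/
structure SupportCondition extends SupportFamily (AdelicSpace G Kinf) where
  saturate_mem : ∀ Z ∈ sets, ∀ K : Level G Kinf,
    {x | ∃ z ∈ Z, ∃ k ∈ K.toSubgroup, x = AdelicSpace.mul z k} ∈ sets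

/-- The family is stable under translation by `t⁻¹`: `Z.t⁻¹ = {x | x.t ∈ Z}` belongs to it for every
member `Z`. -/
def SupportCondition.StableUnder (Φ : SupportCondition G Kinf) (t : AdelicNat G Kinf) : Prop :=
  ∀ Z ∈ Φ.sets, {x | AdelicSpace.mul x t ∈ Z} ∈ Φ.sets

theorem SupportCondition.StableUnder.mul {Φ : SupportCondition G Kinf} {s t : AdelicNat G Kinf}
    (ht : Φ.StableUnder t) (hs : Φ.StableUnder s) : Φ.StableUnder (t * s) := fun Z hZ => by
  have h := ht _ (hs Z hZ)
  simpa only [Set.mem_ofPred_eq, AdelicSpace.mul_mul'] using h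

/-- The orbit relation of `K` on `𝒳`. -/
def levelSetoid (K : Level G Kinf) : Setoid (AdelicSpace G Kinf) where
  r x x' := ∃ k ∈ K.toSubgroup, AdelicSpace.mul x k = x'
  iseqv :=
    { refl := fun x => ⟨1, one_mem _, AdelicSpace.mul_one' x⟩
      symm := by
        rintro x _ ⟨k, hk, rfl⟩
        exact ⟨k⁻¹, inv_mem hk, by
          rw [← AdelicSpace.mul_mul', mul_inv_cancel, AdelicSpace.mul_one']⟩
      trans := by
        rintro x _ _ ⟨k, hk, rfl⟩ ⟨l, hl, rfl⟩
        exact ⟨k * l, mul_mem hk hl, AdelicSpace.mul_mul' _ _ _⟩ }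

/-- The space `S_K = 𝒳 / K`, with the quotient topology (lifted to the universe in which the
coefficient modules live). -/
def space (K : Level G Kinf) : TopCat.{v} := TopCat.of (ULift.{v} (Quotient (levelSetoid K)))

/-- The quotient map `𝒳 → S_K`. -/
def toSpace (K : Level G Kinf) (x : AdelicSpace G Kinf) : space.{v} K := ULift.up (Quotient.mk _ x)

theorem continuous_toSpace (K : Level G Kinf) : Continuous (toSpace.{v} K) :=
  continuous_uliftUp.comp continuous_quotient_mk'

theorem toSpace_mul (K : Level G Kinf) (x : AdelicSpace G Kinf) {k : AdelicNat G Kinf}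
    (hk : k ∈ K.toSubgroup) : toSpace.{v} K (AdelicSpace.mul x k) = toSpace K x :=
  congrArg ULift.up (Quotient.sound (s := levelSetoid K) ⟨k, hk, rfl⟩).symm

/-- The map `G(𝔸) / K_∞° → S_K`. -/
def proj (K : Level G Kinf) (y : AdelicCoset G Kinf) : space.{v} K :=
  toSpace K (Quotient.mk (rationalSetoid G Kinf) y)

theorem proj_mul (K : Level G Kinf) (y : AdelicCoset G Kinf) {k : AdelicNat G Kinf}
    (hk : k ∈ K.toSubgroup) : proj.{v} K (y.mul k) = proj K y :=
  toSpace_mul K (Quotient.mk (rationalSetoid G Kinf) y) hk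

theorem proj_act (K : Level G Kinf) (γ : G.points ℚ) (y : AdelicCoset G Kinf) :
    proj.{v} K (y.act γ) = proj K y :=
  congrArg (toSpace K) (Quotient.sound (s := rationalSetoid G Kinf) ⟨γ, rfl⟩).symm

/-- The map `S_{K'} → S_K` given by `x ↦ x.t`, when `t⁻¹ K' t ⊆ K`. -/
def translation (K K' : Level G Kinf) (t : AdelicNat G Kinf)
    (h : ∀ k ∈ K'.toSubgroup, t⁻¹ * k * t ∈ K.toSubgroup) : space.{v} K' ⟶ space.{v} K :=
  TopCat.ofHom
    { toFun := fun x => Quotient.lift (s := levelSetoid K')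
        (fun x => toSpace K (AdelicSpace.mul x t)) (by
          rintro x _ ⟨k, hk, rfl⟩
          have : k * t = t * (t⁻¹ * k * t) := by group
          rw [← AdelicSpace.mul_mul', this, AdelicSpace.mul_mul', toSpace_mul K _ (h k hk)]) x.down
      continuous_toFun := (((continuous_toSpace K).comp
        (AdelicSpace.continuous_mul t)).quotient_lift _).comp continuous_uliftDown }

/-- The natural map `S_{K'} → S_K` for `K' ⊆ K`. -/
def levelMap (K K' : Level G Kinf) (h : K'.toSubgroup ≤ K.toSubgroup) :
    space.{v} K' ⟶ space.{v} K :=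
  TopCat.ofHom
    { toFun := fun x => Quotient.lift (s := levelSetoid K') (toSpace K) (by
          rintro x _ ⟨k, hk, rfl⟩
          exact (toSpace_mul K x (h hk)).symm) x.down
      continuous_toFun := ((continuous_toSpace K).quotient_lift _).comp continuous_uliftDown }

/-- The family `Φ / K` of closed subsets of `S_K` whose preimage in `𝒳` belongs to `Φ`. -/
def SupportCondition.level (Φ : SupportCondition G Kinf) (K : Level G Kinf) :
    SupportFamily (space.{v} K) where
  sets := {Z | IsClosed Z ∧ toSpace K ⁻¹' Z ∈ Φ.sets}
  isClosed _ hZ := hZ.1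
  empty_mem := ⟨isClosed_empty, Φ.empty_mem⟩
  subset_mem _ hZ _ hZ' h := ⟨hZ', Φ.subset_mem _ hZ.2 _ (hZ'.preimage (continuous_toSpace K))
    (Set.preimage_mono h)⟩
  union_mem _ hZ _ hZ' := ⟨hZ.1.union hZ'.1, Φ.union_mem _ hZ.2 _ hZ'.2⟩

variable {R : Type u} [CommRing R] {GG GG' : Subgroup (AdelicNat G Kinf)}
variable {M M' : Type v} [AddCommGroup M] [Module R M] [AddCommGroup M'] [Module R M']

/-- The sections over `U ⊆ S_K` of the local system `M_[K] = G(ℚ) \ (G(𝔸) / K_∞° × M) / K`, where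
`M` is an `R[G(ℚ) × GG]`-module and `K ⊆ GG`. A section assigns to the class of `y` the class of
`(y, f y)`, where `f` is a function on the preimage of `U` in `G(𝔸) / K_∞°` such that
`f (γ.y.k) = (γ, k⁻¹).f y` for `γ ∈ G(ℚ)` and `k ∈ K`. Since the class of `(x, h)` in `S_K` has a
neighbourhood which is the image of a neighbourhood of `x` in `G(ℝ) / K_∞° × {h}`, the section is
locally constant if and only if `f` is locally constant in the archimedean variable. -/
def localSections (ρ : Representation R (G.points ℚ × GG) M) (K : Level G Kinf)
    (hK : K.toSubgroup ≤ GG) (U : Opens (space.{v} K)) :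
    Submodule R ({y : AdelicCoset G Kinf // proj K y ∈ U} → M) where
  carrier := {f |
    (∀ (y y' : {y : AdelicCoset G Kinf // proj K y ∈ U}) (γ : G.points ℚ) (k : AdelicNat G Kinf)
      (hk : k ∈ K.toSubgroup), y'.1 = (y.1.mul k).act γ →
        f y' = ρ (γ, ⟨k⁻¹, hK (inv_mem hk)⟩) (f y)) ∧
    ∀ y : {y : AdelicCoset G Kinf // proj K y ∈ U}, ∀ᶠ x in nhds y.1.1,
      ∀ hx : proj K (x, y.1.2) ∈ U, f ⟨(x, y.1.2), hx⟩ = f y}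
  zero_mem' := ⟨fun _ _ _ _ _ _ => (map_zero _).symm,
    fun _ => Filter.Eventually.of_forall fun _ _ => rfl⟩
  add_mem' {f g} hf hg := by
    refine ⟨fun y y' γ k hk h => ?_, fun y => ?_⟩
    · rw [Pi.add_apply, Pi.add_apply, map_add, hf.1 y y' γ k hk h, hg.1 y y' γ k hk h]
    · filter_upwards [hf.2 y, hg.2 y] with x h1 h2 hx
      rw [Pi.add_apply, Pi.add_apply, h1 hx, h2 hx]
  smul_mem' r f hf := by
    refine ⟨fun y y' γ k hk h => ?_, fun y => ?_⟩
    · rw [Pi.smul_apply, Pi.smul_apply, map_smul, hf.1 y y' γ k hk h]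
    · filter_upwards [hf.2 y] with x h1 hx
      rw [Pi.smul_apply, Pi.smul_apply, h1 hx]

/-- The sheaf of sections of the local system `M_[K]` on `S_K`. -/
def localSystem (ρ : Representation R (G.points ℚ × GG) M) (K : Level G Kinf)
    (hK : K.toSubgroup ≤ GG) : Psh R (space.{v} K) where
  obj U := ModuleCat.of R (localSections ρ K hK U.unop)
  map i := ModuleCat.ofHom
    { toFun := fun f => ⟨fun y => f.1 ⟨y.1, i.unop.le y.2⟩,
        fun y y' γ k hk h => f.2.1 ⟨y.1, i.unop.le y.2⟩ ⟨y'.1, i.unop.le y'.2⟩ γ k hk h,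
        fun y => (f.2.2 ⟨y.1, i.unop.le y.2⟩).mono fun _ hx hx' => hx (i.unop.le hx')⟩
      map_add' := fun _ _ => rfl
      map_smul' := fun _ _ => rfl }
  map_id _ := rfl
  map_comp _ _ := rfl

/-- For `K' ⊆ K`, the identification of `M_[K']` with the pullback of `M_[K]`, in the form of a
morphism from `M_[K]` to the direct image of `M_[K']`. -/
def localPull (ρ : Representation R (G.points ℚ × GG) M) (K K' : Level G Kinf)
    (hK : K.toSubgroup ≤ GG) (h : K'.toSubgroup ≤ K.toSubgroup) :
    localSystem ρ K hK ⟶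
      (TopCat.Presheaf.pushforward _ (levelMap K K' h)).obj (localSystem ρ K' (h.trans hK)) where
  app U := ModuleCat.ofHom
    { toFun := fun (f : localSections ρ K hK U.unop) =>
        (⟨fun y => f.1 ⟨y.1, y.2⟩,
          fun y y' γ k hk e => f.2.1 ⟨y.1, y.2⟩ ⟨y'.1, y'.2⟩ γ k (h hk) e,
          fun y => f.2.2 ⟨y.1, y.2⟩⟩ :
          localSections ρ K' (h.trans hK) ((Opens.map (levelMap K K' h)).obj U.unop))
      map_add' := fun _ _ => rfl
      map_smul' := fun _ _ => rfl }
  naturality _ _ _ := rfl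

/-- The value at `y` of the trace of a section `f` of `M_[K']`, for `K' ⊆ K`:
the sum of `k.f(y.k)` over `k ∈ K / K'`. -/
def traceFun (ρ : Representation R (G.points ℚ × GG) M) (K K' : Level G Kinf)
    (hK : K.toSubgroup ≤ GG) (h : K'.toSubgroup ≤ K.toSubgroup) (U : Opens (space.{v} K))
    (f : {y : AdelicCoset G Kinf // proj K' y ∈ (Opens.map (levelMap K K' h)).obj U} → M)
    (y : {y : AdelicCoset G Kinf // proj K y ∈ U}) : M :=
  ∑ c : K.toSubgroup ⧸ K'.toSubgroup.subgroupOf K.toSubgroup,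
    ρ (1, ⟨c.out.1, hK c.out.2⟩)
      (f ⟨y.1.mul c.out.1, (proj_mul K y.1 c.out.2 ▸ y.2 : proj K (y.1.mul c.out.1) ∈ U)⟩)

theorem trace_term (ρ : Representation R (G.points ℚ × GG) M) {K K' : Level G Kinf}
    (hK : K.toSubgroup ≤ GG) (h : K'.toSubgroup ≤ K.toSubgroup) (U : Opens (space.{v} K))
    (f : localSections ρ K' (h.trans hK) ((Opens.map (levelMap K K' h)).obj U))
    (y : {y : AdelicCoset G Kinf // proj K y ∈ U}) (k l : K.toSubgroup) (γ : G.points ℚ)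
    (hm : l.1⁻¹ * k.1 ∈ K'.toSubgroup) (hy hy') :
    ρ (1, ⟨k.1, hK k.2⟩) (f.1 ⟨(y.1.mul k.1).act γ, hy⟩) =
      ρ (γ, ⟨l.1, hK l.2⟩) (f.1 ⟨y.1.mul l.1, hy'⟩) := by
  rw [f.2.1 ⟨y.1.mul l.1, hy'⟩ ⟨(y.1.mul k.1).act γ, hy⟩ γ _ hm (by
    rw [← AdelicCoset.mul_mul', mul_inv_cancel_left]), ← Module.End.mul_apply, ← map_mul]
  refine congrArg (fun g => ρ g _) (Prod.ext (one_mul γ) (Subtype.ext ?_))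
  simp

theorem trace_summand (ρ : Representation R (G.points ℚ × GG) M) {K K' : Level G Kinf}
    (hK : K.toSubgroup ≤ GG) (h : K'.toSubgroup ≤ K.toSubgroup) (U : Opens (space.{v} K))
    (f : localSections ρ K' (h.trans hK) ((Opens.map (levelMap K K' h)).obj U))
    (y : {y : AdelicCoset G Kinf // proj K y ∈ U}) (k c c' : K.toSubgroup) (γ : G.points ℚ)
    (hm : c'.1⁻¹ * (k.1 * c.1) ∈ K'.toSubgroup) (hy hy') :
    ρ (1, ⟨c.1, hK c.2⟩) (f.1 ⟨((y.1.mul k.1).act γ).mul c.1, hy⟩) =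
      ρ (γ, ⟨k.1⁻¹, hK (inv_mem k.2)⟩) (ρ (1, ⟨c'.1, hK c'.2⟩) (f.1 ⟨y.1.mul c'.1, hy'⟩)) := by
  have hz : (y.1.mul (k.1 * c.1)).act γ = ((y.1.mul k.1).act γ).mul c.1 := by
    rw [← AdelicCoset.act_mul, ← AdelicCoset.mul_mul']
  have hy1 : proj K' ((y.1.mul (k.1 * c.1)).act γ) ∈ (Opens.map (levelMap K K' h)).obj U := by
    rw [hz]
    exact hy
  have hf : f.1 ⟨((y.1.mul k.1).act γ).mul c.1, hy⟩ =
      f.1 ⟨(y.1.mul (k.1 * c.1)).act γ, hy1⟩ := congrArg f.1 (Subtype.ext hz.symm)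
  have ht := congrArg (ρ (1, ⟨k.1⁻¹, hK (inv_mem k.2)⟩))
    (trace_term ρ hK h U f y (k * c) c' γ hm hy1 hy')
  rw [← Module.End.mul_apply, ← map_mul, ← Module.End.mul_apply, ← map_mul] at ht
  rw [← Module.End.mul_apply, ← map_mul, hf]
  refine Eq.trans ?_ (ht.trans ?_)
  · refine congrArg (fun g => ρ g _) (Prod.ext (mul_one _).symm (Subtype.ext ?_))
    exact (inv_mul_cancel_left k.1 c.1).symm
  · refine congrArg (fun g => ρ g _) (Prod.ext ?_ rfl)
    exact (one_mul γ).trans (mul_one γ).symm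

theorem traceFun_mem (ρ : Representation R (G.points ℚ × GG) M) (K K' : Level G Kinf)
    (hK : K.toSubgroup ≤ GG) (h : K'.toSubgroup ≤ K.toSubgroup) (U : Opens (space.{v} K))
    (f : localSections ρ K' (h.trans hK) ((Opens.map (levelMap K K' h)).obj U)) :
    traceFun ρ K K' hK h U f.1 ∈ localSections ρ K hK U := by
  refine ⟨?_, fun y => ?_⟩
  · rintro y ⟨_, hy'⟩ γ k hk rfl
    rw [traceFun, traceFun, map_sum]
    refine Fintype.sum_equiv (MulAction.toPerm (⟨k, hk⟩ : K.toSubgroup)) _ _ fun c => ?_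
    refine trace_summand ρ hK h U f y ⟨k, hk⟩ c.out _ γ ?_ _ _
    have h1 : ((⟨k, hk⟩ : K.toSubgroup) • c).out⁻¹ * (⟨k, hk⟩ * c.out) ∈
        K'.toSubgroup.subgroupOf K.toSubgroup := by
      rw [← QuotientGroup.eq, QuotientGroup.out_eq']
      conv_lhs => rw [← QuotientGroup.out_eq' c]
      rfl
    exact h1
  · have hc : ∀ c : K.toSubgroup ⧸ K'.toSubgroup.subgroupOf K.toSubgroup,
        ∀ᶠ x in nhds y.1.1, ∀ hx, f.1 ⟨AdelicCoset.mul (x, y.1.2) c.out.1, hx⟩ =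
          f.1 ⟨y.1.mul c.out.1,
            (proj_mul K y.1 c.out.2 ▸ y.2 : proj K (y.1.mul c.out.1) ∈ U)⟩ := fun c =>
      (continuous_infMul (c.out.1.1)).continuousAt.eventually (f.2.2 ⟨y.1.mul c.out.1,
        (proj_mul K y.1 c.out.2 ▸ y.2 : proj K (y.1.mul c.out.1) ∈ U)⟩)
    filter_upwards [Filter.eventually_all.2 hc] with x hx hxU
    exact Finset.sum_congr rfl fun c _ => congrArg _ (hx c _)

/-- The trace from the direct image of `M_[K']` to `M_[K]`, for `K' ⊆ K`: on the fibre over the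
class of `y`, it is the sum over the points of the fibre of `S_{K'} → S_K`, which are the classes of
`y.k` for `k ∈ K / K'`. -/
def localTrace (ρ : Representation R (G.points ℚ × GG) M) (K K' : Level G Kinf)
    (hK : K.toSubgroup ≤ GG) (h : K'.toSubgroup ≤ K.toSubgroup) :
    (TopCat.Presheaf.pushforward _ (levelMap K K' h)).obj (localSystem ρ K' (h.trans hK)) ⟶
      localSystem ρ K hK where
  app U := ModuleCat.ofHom
    { toFun := fun (f : localSections ρ K' (h.trans hK)
          ((Opens.map (levelMap K K' h)).obj U.unop)) =>
        (⟨traceFun ρ K K' hK h U.unop f.1, traceFun_mem ρ K K' hK h U.unop f⟩ :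
          localSections ρ K hK U.unop)
      map_add' := fun f g => Subtype.ext <| funext fun y => by
        simp [traceFun, Finset.sum_add_distrib]
      map_smul' := fun r f => Subtype.ext <| funext fun y => by
        simp [traceFun, Finset.smul_sum] }
  naturality _ _ _ := rfl

/-- `φ` is `G(ℚ)`-equivariant. -/
def IsRationalEquivariant (ρ : Representation R (G.points ℚ × GG) M)
    (ρ' : Representation R (G.points ℚ × GG') M') (φ : M →ₗ[R] M') : Prop :=
  ∀ (γ : G.points ℚ) (m : M), φ (ρ (γ, 1) m) = ρ' (γ, 1) (φ m)

/-- `t` is `φ`-adapted: `φ (g.m) = (t g t⁻¹).φ(m)` for all `g ∈ GG ∩ t⁻¹ GG' t`. -/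
def IsAdapted (ρ : Representation R (G.points ℚ × GG) M)
    (ρ' : Representation R (G.points ℚ × GG') M') (φ : M →ₗ[R] M') (t : AdelicNat G Kinf) : Prop :=
  ∀ (g : AdelicNat G Kinf) (hg : g ∈ GG) (hg' : t * g * t⁻¹ ∈ GG') (m : M),
    φ (ρ (1, ⟨g, hg⟩) m) = ρ' (1, ⟨t * g * t⁻¹, hg'⟩) (φ m)

theorem IsRationalEquivariant.comp {GG'' : Subgroup (AdelicNat G Kinf)} {M'' : Type v}
    [AddCommGroup M''] [Module R M''] {ρ : Representation R (G.points ℚ × GG) M}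
    {ρ' : Representation R (G.points ℚ × GG') M'} {ρ'' : Representation R (G.points ℚ × GG'') M''}
    {φ : M →ₗ[R] M'} {ψ : M' →ₗ[R] M''} (hψ : IsRationalEquivariant ρ' ρ'' ψ)
    (hφ : IsRationalEquivariant ρ ρ' φ) : IsRationalEquivariant ρ ρ'' (ψ ∘ₗ φ) := fun γ m => by
  rw [LinearMap.comp_apply, hφ, hψ, LinearMap.comp_apply]

theorem localTranslate_mem (ρ : Representation R (G.points ℚ × GG) M)
    (ρ' : Representation R (G.points ℚ × GG') M') (φ : M →ₗ[R] M') (t : AdelicNat G Kinf)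
    (hφ : IsRationalEquivariant ρ ρ' φ) (ht : IsAdapted ρ ρ' φ t) (K K' : Level G Kinf)
    (hK : K.toSubgroup ≤ GG) (hK' : K'.toSubgroup ≤ GG')
    (h : ∀ k ∈ K'.toSubgroup, t⁻¹ * k * t ∈ K.toSubgroup) (U : Opens (space.{v} K))
    (f : localSections ρ K hK U) :
    (fun y => φ (f.1 ⟨y.1.mul t, y.2⟩)) ∈
      localSections ρ' K' hK' ((Opens.map (translation K K' t h)).obj U) := by
  refine ⟨?_, fun y => ?_⟩
  · rintro y ⟨_, hy'⟩ γ k hk rfl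
    have h0 : ((y.1.mul k).act γ).mul t = ((y.1.mul t).mul (t⁻¹ * k * t)).act γ := by
      rw [← AdelicCoset.act_mul, ← AdelicCoset.mul_mul', ← AdelicCoset.mul_mul', mul_assoc t⁻¹,
        mul_inv_cancel_left]
    have h1 : f.1 ⟨((y.1.mul k).act γ).mul t, hy'⟩ = _ :=
      f.2.1 ⟨y.1.mul t, y.2⟩ ⟨((y.1.mul k).act γ).mul t, hy'⟩ γ _ (h k hk) h0
    have h2 : ((γ, ⟨(t⁻¹ * k * t)⁻¹, hK (inv_mem (h k hk))⟩) : G.points ℚ × GG) =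
        (γ, 1) * (1, ⟨(t⁻¹ * k * t)⁻¹, hK (inv_mem (h k hk))⟩) :=
      Prod.ext (mul_one γ).symm (one_mul _).symm
    have h3 : t * (t⁻¹ * k * t)⁻¹ * t⁻¹ = k⁻¹ := by
      simp only [mul_inv_rev, inv_inv, mul_assoc, mul_inv_cancel_left, mul_inv_cancel, mul_one]
    have h4 : ((γ, ⟨t * (t⁻¹ * k * t)⁻¹ * t⁻¹, by rw [h3]; exact hK' (inv_mem hk)⟩) :
        G.points ℚ × GG') = (γ, ⟨k⁻¹, hK' (inv_mem hk)⟩) :=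
      Prod.ext rfl (Subtype.ext h3)
    refine (congrArg φ h1).trans ?_
    rw [h2, map_mul, Module.End.mul_apply, hφ,
      ht _ _ (by rw [h3]; exact hK' (inv_mem hk)), ← Module.End.mul_apply, ← map_mul, ← h4]
    exact congrArg (fun g => ρ' g _) (Prod.ext (mul_one γ) (one_mul _))
  · filter_upwards [(continuous_infMul t.1).continuousAt.eventually
      (f.2.2 ⟨y.1.mul t, y.2⟩)] with x hx hx'
    exact congrArg φ (hx hx')

/-- The morphism `M_[K] → M'_[K']` of local systems over `S_K → S_{K'}`, `x ↦ x.t⁻¹`, induced by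
`(x, u) ↦ (x.t⁻¹, φ u)`, where `t⁻¹ K' t ⊆ K`; it is given here in terms of the map
`S_{K'} → S_K`, `x ↦ x.t` in the opposite direction. -/
def localTranslate (ρ : Representation R (G.points ℚ × GG) M)
    (ρ' : Representation R (G.points ℚ × GG') M') (φ : M →ₗ[R] M') (t : AdelicNat G Kinf)
    (hφ : IsRationalEquivariant ρ ρ' φ) (ht : IsAdapted ρ ρ' φ t) (K K' : Level G Kinf)
    (hK : K.toSubgroup ≤ GG) (hK' : K'.toSubgroup ≤ GG')
    (h : ∀ k ∈ K'.toSubgroup, t⁻¹ * k * t ∈ K.toSubgroup) :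
    localSystem ρ K hK ⟶
      (TopCat.Presheaf.pushforward _ (translation K K' t h)).obj (localSystem ρ' K' hK') where
  app U := ModuleCat.ofHom
    { toFun := fun (f : localSections ρ K hK U.unop) =>
        (⟨fun y => φ (f.1 ⟨y.1.mul t, y.2⟩),
          localTranslate_mem ρ ρ' φ t hφ ht K K' hK hK' h U.unop f⟩ :
          localSections ρ' K' hK' ((Opens.map (translation K K' t h)).obj U.unop))
      map_add' := fun _ _ => Subtype.ext <| funext fun _ => map_add φ _ _
      map_smul' := fun _ _ => Subtype.ext <| funext fun _ => map_smul φ _ _ }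
  naturality _ _ _ := rfl

/-- The cohomology `H^i_Φ(K, M) = H^i_{Φ/K}(S_K, M_[K])`. -/
def levelCohomology (Φ : SupportCondition G Kinf) (ρ : Representation R (G.points ℚ × GG) M)
    (K : Level G Kinf) (hK : K.toSubgroup ≤ GG) (i : ℤ) : ModuleCat.{v} R :=
  cohomology (Φ.level K) (localSystem ρ K hK) i

theorem SupportCondition.level_preimage (Φ : SupportCondition G Kinf) (K K' : Level G Kinf)
    (h : K'.toSubgroup ≤ K.toSubgroup) :
    ∀ Z ∈ (Φ.level.{v} K).sets, levelMap K K' h ⁻¹' Z ∈ (Φ.level K').sets :=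
  fun _ hZ => ⟨hZ.1.preimage (levelMap K K' h).hom.continuous, hZ.2⟩

/-- The pullback `H^i_Φ(K, M) → H^i_Φ(K', M)` for `K' ⊆ K`. -/
def pullback (Φ : SupportCondition G Kinf) (ρ : Representation R (G.points ℚ × GG) M)
    (K K' : Level G Kinf) (hK : K.toSubgroup ≤ GG) (h : K'.toSubgroup ≤ K.toSubgroup) (i : ℤ) :
    levelCohomology Φ ρ K hK i ⟶ levelCohomology Φ ρ K' (h.trans hK) i :=
  cohomologyMap (levelMap K K' h) (Φ.level_preimage K K' h) (localPull ρ K K' hK h) i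

/-- The push-forward `H^i_Φ(K', M) → H^i_Φ(K, M)` along the finite covering `S_{K'} → S_K`, for
`K' ⊆ K`. -/
def pushForward (Φ : SupportCondition G Kinf) (ρ : Representation R (G.points ℚ × GG) M)
    (K K' : Level G Kinf) (hK : K.toSubgroup ≤ GG) (h : K'.toSubgroup ≤ K.toSubgroup) (i : ℤ) :
    levelCohomology Φ ρ K' (h.trans hK) i ⟶ levelCohomology Φ ρ K hK i :=
  cohomologyPush (levelMap K K' h) (Φ.level_preimage K K' h) (localTrace ρ K K' hK h) i

/-- The homomorphism `H^i_Φ(K, M) → H^i_Φ(K', M')` induced by `(x, u) ↦ (x.t⁻¹, φ u)`, where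
`t⁻¹ K' t ⊆ K`. -/
def translate (Φ : SupportCondition G Kinf) (ρ : Representation R (G.points ℚ × GG) M)
    (ρ' : Representation R (G.points ℚ × GG') M') (φ : M →ₗ[R] M') (t : AdelicNat G Kinf)
    (hφ : IsRationalEquivariant ρ ρ' φ) (ht : IsAdapted ρ ρ' φ t) (hΦ : Φ.StableUnder t)
    (K K' : Level G Kinf) (hK : K.toSubgroup ≤ GG) (hK' : K'.toSubgroup ≤ GG')
    (h : ∀ k ∈ K'.toSubgroup, t⁻¹ * k * t ∈ K.toSubgroup) (i : ℤ) :
    levelCohomology Φ ρ K hK i ⟶ levelCohomology Φ ρ' K' hK' i :=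
  cohomologyMap (Φ := Φ.level K) (Φ' := Φ.level K') (translation K K' t h)
    (fun _ hZ => ⟨hZ.1.preimage (translation K K' t h).hom.continuous, hΦ _ hZ.2⟩)
    (localTranslate ρ ρ' φ t hφ ht K K' hK hK' h) i

/-- The Hecke homomorphism `ρ_{t, φ} : H^i_Φ(K, M) → H^i_Φ(K', M')`: the composition of the pullback
to `K ∩ t⁻¹ K' t`, the map to the cohomology at level `t K t⁻¹ ∩ K'` induced by
`(x, u) ↦ (x.t⁻¹, φ u)`, and the push-forward to `K'`. -/
def heckeHom (Φ : SupportCondition G Kinf) (ρ : Representation R (G.points ℚ × GG) M)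
    (ρ' : Representation R (G.points ℚ × GG') M') (φ : M →ₗ[R] M') (t : AdelicNat G Kinf)
    (hφ : IsRationalEquivariant ρ ρ' φ) (ht : IsAdapted ρ ρ' φ t) (hΦ : Φ.StableUnder t)
    (K K' : Level G Kinf) (hK : K.toSubgroup ≤ GG) (hK' : K'.toSubgroup ≤ GG') (i : ℤ) :
    levelCohomology Φ ρ K hK i ⟶ levelCohomology Φ ρ' K' hK' i :=
  pullback Φ ρ K (K.inter (K'.conj t⁻¹)) hK inf_le_left i ≫
    translate Φ ρ ρ' φ t hφ ht hΦ (K.inter (K'.conj t⁻¹)) ((K.conj t).inter K')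
      (inf_le_left.trans hK) (inf_le_right.trans hK')
      (fun k hk => ⟨Level.mem_conj.1 hk.1, Level.mem_conj.2 (by
        have e : t⁻¹⁻¹ * (t⁻¹ * k * t) * t⁻¹ = k := by
          simp only [inv_inv, mul_assoc, mul_inv_cancel_left, mul_inv_cancel, mul_one]
        rw [e]
        exact hk.2)⟩) i ≫
    pushForward Φ ρ' K' ((K.conj t).inter K') hK' inf_le_right i

end AdelicGroup

end

open AdelicGroup CategoryTheory
open scoped Pointwise

universe u v

/-! A Hecke homomorphism is a correspondence: by `heckeHom_eq`, ρ_{t,φ} from level K to level K' is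
the translation from K to tKt⁻¹ ∩ K' followed by the push-forward to K'. The composite in question
therefore translates by s to B = sK₁s⁻¹ ∩ K₂, pushes to K₂, translates by t to D = tK₂t⁻¹ ∩ K₃ and
pushes to K₃. Put E = tBt⁻¹ ∩ D. The hypothesis on K₂ says that every coset in K₂/B meets t⁻¹Dt = K₂
∩ t⁻¹K₃t, so that d ↦ t⁻¹dt induces a bijection D/E ≅ K₂/B. Hence the traces along S_E → S_D and S_B
→ S_{K₂} match term by term, and the middle push-forward and translation can be exchanged
(`pushForward_translate`). What remains is the translation by ts to level E, followed by the
push-forward to K₃. Both maps factor through B' = tsK₁(ts)⁻¹ ∩ K₃ ⊇ E, the level that occurs in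
ρ_{ts}, and pullback followed by push-forward between B' and E is multiplication by [B' : E]
(`localPull_localTrace`). Conjugation by t identifies this with the index in the statement.

The push-forward inverts the canonical map from the cohomology of f_*G to that of G, so everything
rests on `isIso_directImageMap`. This holds because S_{K'} → S_K is closed, with finite fibres in a
Hausdorff space: a stalk of f_*G is then the product of the stalks of G along the fibre, and f_*
commutes with each step of the Godement resolution (`godementMap_bijective`,
`iterCokerMap_bijective`). The Hausdorff property comes from the closedness of G(ℚ) in the adelic
points and the compactness of K_∞ and K (`t2Space_space`). Once the map is invertible, base change
(`cohomologyPush_comp_map`) and transitivity (`cohomologyPush_comp`) reduce to identities between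
sums over cosets. -/

noncomputable section

/-! ### Functoriality of cohomology with supports. -/

namespace SupportCohomology

open CategoryTheory TopologicalSpace Opposite

variable {R : Type u} [CommRing R] {X Y Z : TopCat.{v}}

theorem stalk_exists_germ (F : Psh R X) (x : X) (a : F.stalk x) :
    ∃ (U : Opens X) (hx : x ∈ U) (s : F.obj (op U)), F.germ U x hx s = a :=
  TopCat.Presheaf.exists_germ_eq F a

/-- A morphism `m : F ⟶ h_* H` is the composition of `k : F ⟶ f_* G` and `l : G ⟶ g_* H`, where
`h = g ≫ f`. -/
def IsComp (f : Y ⟶ X) (g : Z ⟶ Y) (h : Z ⟶ X) (e : h = g ≫ f) {F : Psh R X} {G : Psh R Y}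
    {H : Psh R Z} (k : F ⟶ (TopCat.Presheaf.pushforward _ f).obj G)
    (l : G ⟶ (TopCat.Presheaf.pushforward _ g).obj H)
    (m : F ⟶ (TopCat.Presheaf.pushforward _ h).obj H) : Prop :=
  ∀ (U : Opens X) (s : F.obj (op U)), m.app (op U) s =
    H.map (eqToHom (by rw [e]; rfl) :
        (Opens.map h).obj U ⟶ (Opens.map g).obj ((Opens.map f).obj U)).op
      (l.app (op ((Opens.map f).obj U)) (k.app (op U) s))

/-- When h is literally g ≫ f, the restriction along `eqToHom` is the identity. The general form of
`IsComp` serves for translations and level maps, whose compositions are identified by a proved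
equality. -/
theorem isComp_iff {f : Y ⟶ X} {g : Z ⟶ Y} {F : Psh R X} {G : Psh R Y}
    {H : Psh R Z} {k : F ⟶ (TopCat.Presheaf.pushforward _ f).obj G}
    {l : G ⟶ (TopCat.Presheaf.pushforward _ g).obj H}
    {m : F ⟶ (TopCat.Presheaf.pushforward _ (g ≫ f)).obj H} :
    IsComp f g (g ≫ f) rfl k l m ↔ ∀ (U : Opens X) (s : F.obj (op U)), m.app (op U) s =
      l.app (op ((Opens.map f).obj U)) (k.app (op U) s) := by
  refine forall_congr' fun U => forall_congr' fun s => ?_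
  have h := congrArg (fun q => q (l.app (op ((Opens.map f).obj U)) (k.app (op U) s)))
    (H.map_id (op ((Opens.map g).obj ((Opens.map f).obj U))))
  exact ⟨fun e => e.trans h, fun e => e.trans h.symm⟩

theorem stalkMap_comp {f : Y ⟶ X} {g : Z ⟶ Y} {F : Psh R X} {G : Psh R Y}
    {H : Psh R Z} {k : F ⟶ (TopCat.Presheaf.pushforward _ f).obj G}
    {l : G ⟶ (TopCat.Presheaf.pushforward _ g).obj H}
    {m : F ⟶ (TopCat.Presheaf.pushforward _ (g ≫ f)).obj H}
    (hm : IsComp f g (g ≫ f) rfl k l m) (z : Z) (a : F.stalk (f (g z))) :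
    stalkMap (g ≫ f) m z a = stalkMap g l z (stalkMap f k (g z) a) := by
  obtain ⟨U, hx, s, rfl⟩ := stalk_exists_germ F _ a
  refine (stalkMap_germ (g ≫ f) m U z hx s).trans ?_
  rw [isComp_iff.1 hm]
  refine Eq.trans ?_ (congrArg (stalkMap g l z) (stalkMap_germ f k U (g z) hx s).symm)
  exact (stalkMap_germ g l ((Opens.map f).obj U) z hx _).symm

theorem IsComp.godementMap {f : Y ⟶ X} {g : Z ⟶ Y} {F : Psh R X} {G : Psh R Y}
    {H : Psh R Z} {k : F ⟶ (TopCat.Presheaf.pushforward _ f).obj G}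
    {l : G ⟶ (TopCat.Presheaf.pushforward _ g).obj H}
    {m : F ⟶ (TopCat.Presheaf.pushforward _ (g ≫ f)).obj H}
    (hm : IsComp f g (g ≫ f) rfl k l m) :
    IsComp f g (g ≫ f) rfl (godementMap f k) (godementMap g l) (godementMap (g ≫ f) m) :=
  isComp_iff.2 fun _ s => funext fun z => stalkMap_comp hm z.1 (s ⟨f (g z.1), z.2⟩)

theorem IsComp.cokerMap {f : Y ⟶ X} {g : Z ⟶ Y} {F : Psh R X} {G : Psh R Y}
    {H : Psh R Z} {k : F ⟶ (TopCat.Presheaf.pushforward _ f).obj G}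
    {l : G ⟶ (TopCat.Presheaf.pushforward _ g).obj H}
    {m : F ⟶ (TopCat.Presheaf.pushforward _ (g ≫ f)).obj H}
    (hm : IsComp f g (g ≫ f) rfl k l m) :
    IsComp f g (g ≫ f) rfl (cokerMap f k) (cokerMap g l) (cokerMap (g ≫ f) m) :=
  isComp_iff.2 fun U s => by
    obtain ⟨s, rfl⟩ := Submodule.Quotient.mk_surjective _ s
    exact congrArg (Submodule.Quotient.mk (p := LinearMap.range ((toGodement H).app _).hom))
      (isComp_iff.1 hm.godementMap U s)

theorem IsComp.iterCokerMap {f : Y ⟶ X} {g : Z ⟶ Y} {F : Psh R X} {G : Psh R Y}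
    {H : Psh R Z} {k : F ⟶ (TopCat.Presheaf.pushforward _ f).obj G}
    {l : G ⟶ (TopCat.Presheaf.pushforward _ g).obj H}
    {m : F ⟶ (TopCat.Presheaf.pushforward _ (g ≫ f)).obj H}
    (hm : IsComp f g (g ≫ f) rfl k l m) : ∀ n, IsComp f g (g ≫ f) rfl
      (iterCokerMap f k n) (iterCokerMap g l n) (iterCokerMap (g ≫ f) m n)
  | 0 => hm
  | n + 1 => (hm.iterCokerMap n).cokerMap

/-- Compatibility has to be checked only on sections of the coefficient presheaves: it passes to
stalks, hence to C⁰, to the cokernel, and by induction to the whole resolution. A commutative square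
is handled as two factorisations of a single map h. -/
theorem cohomologyMap_comp {Φ : SupportFamily X} {Φ' : SupportFamily Y} {Φ'' : SupportFamily Z}
    {f : Y ⟶ X} {g : Z ⟶ Y} {h : Z ⟶ X} (e : h = g ≫ f)
    (hf : ∀ Z ∈ Φ.sets, f ⁻¹' Z ∈ Φ'.sets) (hg : ∀ Z ∈ Φ'.sets, g ⁻¹' Z ∈ Φ''.sets)
    (hh : ∀ Z ∈ Φ.sets, h ⁻¹' Z ∈ Φ''.sets) {F : Psh R X} {G : Psh R Y}
    {H : Psh R Z} {k : F ⟶ (TopCat.Presheaf.pushforward _ f).obj G}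
    {l : G ⟶ (TopCat.Presheaf.pushforward _ g).obj H}
    {m : F ⟶ (TopCat.Presheaf.pushforward _ h).obj H} (hm : IsComp f g h e k l m) (i : ℤ) :
    cohomologyMap f hf k i ≫ cohomologyMap g hg l i = cohomologyMap h hh m i := by
  subst e
  refine (HomologicalComplex.homologyMap_comp _ _ i).symm.trans ?_
  rw [← Functor.map_comp]
  refine congrArg (fun c => HomologicalComplex.homologyMap
    ((ComplexShape.embeddingUpNat.extendFunctor (ModuleCat.{v} R)).map c) i) ?_
  refine HomologicalComplex.hom_ext _ _ fun n => ?_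
  exact ModuleCat.hom_ext <| LinearMap.ext fun s => Subtype.ext
    (isComp_iff.1 (hm.iterCokerMap n).godementMap ⊤ s.1).symm

/-! ### Additivity in the coefficients. -/

section Additivity

variable (f : Y ⟶ X) {F : Psh R X} {G : Psh R Y}

theorem stalkMap_add (k l : F ⟶ (TopCat.Presheaf.pushforward _ f).obj G) (y : Y)
    (a : F.stalk (f y)) : stalkMap f (k + l) y a = stalkMap f k y a + stalkMap f l y a := by
  obtain ⟨U, hx, s, rfl⟩ := stalk_exists_germ F _ a
  rw [stalkMap_germ, stalkMap_germ, stalkMap_germ]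
  exact map_add _ _ _

theorem godementMap_add (k l : F ⟶ (TopCat.Presheaf.pushforward _ f).obj G) :
    godementMap f (k + l) = godementMap f k + godementMap f l := by
  ext U s
  exact funext fun y => stalkMap_add f k l y.1 (s ⟨f y.1, y.2⟩)

theorem cokerMap_add (k l : F ⟶ (TopCat.Presheaf.pushforward _ f).obj G) :
    cokerMap f (k + l) = cokerMap f k + cokerMap f l := by
  ext U s
  obtain ⟨s, rfl⟩ := Submodule.Quotient.mk_surjective _ s
  exact congrArg (Submodule.Quotient.mk (p := LinearMap.range ((toGodement G).app _).hom))
    (congrArg (fun m => m.app (op U) s) (godementMap_add f k l))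

theorem iterCokerMap_add (k l : F ⟶ (TopCat.Presheaf.pushforward _ f).obj G) :
    ∀ n, iterCokerMap f (k + l) n = iterCokerMap f k n + iterCokerMap f l n
  | 0 => rfl
  | n + 1 => (congrArg (cokerMap f) (iterCokerMap_add k l n)).trans (cokerMap_add f _ _)

/-- This serves to turn m times the identity of a coefficient presheaf into multiplication by m on
cohomology, which is how the index enters. -/
theorem cohomologyMap_add {Φ : SupportFamily X} {Φ' : SupportFamily Y}
    (hf : ∀ Z ∈ Φ.sets, f ⁻¹' Z ∈ Φ'.sets)
    (k l : F ⟶ (TopCat.Presheaf.pushforward _ f).obj G) (i : ℤ) :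
    cohomologyMap f hf (k + l) i = cohomologyMap f hf k i + cohomologyMap f hf l i := by
  have h : cochainsMap f hf (k + l) = cochainsMap f hf k + cochainsMap f hf l := by
    refine HomologicalComplex.hom_ext _ _ fun n => ?_
    exact ModuleCat.hom_ext <| LinearMap.ext fun s => Subtype.ext <|
      congrArg (fun m => m.app (op ⊤) s.1) <|
        (congrArg (godementMap f) (iterCokerMap_add f k l n)).trans (godementMap_add f _ _)
  rw [cohomologyMap, h, Functor.map_add, HomologicalComplex.homologyMap_add]
  rfl

/-- `cohomologyMap` as an additive map of the morphism of presheaves. -/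
def cohomologyMapHom {Φ : SupportFamily X} {Φ' : SupportFamily Y}
    (hf : ∀ Z ∈ Φ.sets, f ⁻¹' Z ∈ Φ'.sets) (i : ℤ) :
    (F ⟶ (TopCat.Presheaf.pushforward _ f).obj G) →+ (cohomology Φ F i ⟶ cohomology Φ' G i) :=
  AddMonoidHom.mk' (fun k => cohomologyMap f hf k i) fun k l => cohomologyMap_add f hf k l i

theorem cohomologyMap_nsmul {Φ : SupportFamily X} {Φ' : SupportFamily Y}
    (hf : ∀ Z ∈ Φ.sets, f ⁻¹' Z ∈ Φ'.sets)
    (m : ℕ) (k : F ⟶ (TopCat.Presheaf.pushforward _ f).obj G) (i : ℤ) :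
    cohomologyMap f hf (m • k) i = m • cohomologyMap f hf k i :=
  map_nsmul (cohomologyMapHom f hf i) m k

end Additivity

/-- `G` sends disjoint unions of open sets to products. -/
def IsDisjointAdditive (G : Psh R Y) : Prop :=
  ∀ (ι : Type v) (V : ι → Opens Y), Pairwise (Function.onFun Disjoint V) →
    ∀ s : ∀ j, G.obj (op (V j)), ∃! t : G.obj (op (iSup V)), ∀ j,
      G.map (homOfLE (le_iSup V j)).op t = s j

/-! ### Presheaves that are additive on disjoint unions, and closed separating maps. -/

theorem isDisjointAdditive_godement (G : Psh R Y) : IsDisjointAdditive (godement G) := by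
  intro ι V hV s
  have hmem : ∀ y : (iSup V : Opens Y), ∃ j, y.1 ∈ V j := fun y => Opens.mem_iSup.1 y.2
  choose j hj using hmem
  have huniq : ∀ (y : Y) (a b : ι), y ∈ V a → y ∈ V b → a = b := fun y a b ha hb => by
    by_contra hab
    exact (hV hab).le_bot (show y ∈ V a ⊓ V b from ⟨ha, hb⟩)
  refine ⟨fun y => s (j y) ⟨y.1, hj y⟩, fun a => funext fun y => ?_, fun t ht => funext fun y => ?_⟩
  · have h : ∀ b (hb : y.1 ∈ V b), b = a → s b ⟨y.1, hb⟩ = s a y := by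
      rintro b hb rfl
      rfl
    exact h _ (hj ⟨y.1, le_iSup V a y.2⟩) (huniq _ _ _ (hj ⟨y.1, le_iSup V a y.2⟩) y.2)
  · exact congrFun (ht (j y)) ⟨y.1, hj y⟩

/-- Products of modules are exact, so the property passes to presheaf cokernels. This is why
disjoint additivity replaces the sheaf condition: the iterated cokernels are not sheafified. -/
theorem IsDisjointAdditive.godementCoker {G : Psh R Y} (hG : IsDisjointAdditive G) :
    IsDisjointAdditive (godementCoker G) := by
  intro ι V hV s
  choose s' hs' using fun j => Submodule.Quotient.mk_surjective _ (s j)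
  obtain ⟨t, ht, -⟩ := isDisjointAdditive_godement G ι V hV s'
  refine ⟨Submodule.Quotient.mk t, fun j => ?_, fun t₂ ht₂ => ?_⟩
  · exact (congrArg (Submodule.Quotient.mk (p := LinearMap.range ((toGodement G).app _).hom))
      (ht j)).trans (hs' j)
  · obtain ⟨t₂, rfl⟩ := Submodule.Quotient.mk_surjective _ t₂
    refine (Submodule.Quotient.eq _).2 ?_
    -- Two lifts of the same local classes differ on each V j by a section of G; these sections glue
    -- to one whose image is the global difference.
    have hr : ∀ j, ∃ r : G.obj (op (V j)), (toGodement G).app (op (V j)) r =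
        (SupportCohomology.godement G).map (homOfLE (le_iSup V j)).op (t₂ - t) := fun j => by
      refine (Submodule.Quotient.eq _).1 ((ht₂ j).trans ?_)
      rw [← hs' j, ← ht j]
      rfl
    choose r hr using hr
    obtain ⟨q, hq, -⟩ := hG ι V hV r
    refine ⟨q, ?_⟩
    refine (isDisjointAdditive_godement G ι V hV
      (fun j => (SupportCohomology.godement G).map (homOfLE (le_iSup V j)).op (t₂ - t))).unique
      (fun j => ?_) (fun _ => rfl)
    rw [← hr, ← hq]
    exact congrArg (fun m => m q) ((toGodement G).naturality (homOfLE (le_iSup V j)).op).symm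

theorem IsDisjointAdditive.iterCoker {G : Psh R Y} (hG : IsDisjointAdditive G) :
    ∀ n, IsDisjointAdditive (iterCoker G n)
  | 0 => hG
  | n + 1 => (hG.iterCoker n).godementCoker

/-- A closed map, such that the points of a fibre have pairwise disjoint open neighbourhoods. -/
structure IsClosedSeparating (f : Y ⟶ X) : Prop where
  isClosedMap : IsClosedMap f
  exists_disjoint : ∀ x : X, ∃ V : {y : Y // f y = x} → Opens Y,
    (∀ y, y.1 ∈ V y) ∧ Pairwise (Function.onFun Disjoint V)

/-- Tube lemma for a closed map: W is X minus the image of the complement of V. -/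
theorem IsClosedSeparating.exists_nhds {f : Y ⟶ X} (hf : IsClosedSeparating f) (x : X)
    (V : Opens Y) (hV : ∀ y, f y = x → y ∈ V) :
    ∃ W : Opens X, x ∈ W ∧ (Opens.map f).obj W ≤ V := by
  refine ⟨⟨(f '' (V : Set Y)ᶜ)ᶜ, (hf.isClosedMap _ V.2.isClosed_compl).isOpen_compl⟩, ?_, ?_⟩
  · rintro ⟨y, hy, rfl⟩
    exact hy (hV y rfl)
  · intro y hy
    by_contra h
    exact hy ⟨y, h, rfl⟩

theorem germ_eq_zero_iff (G : Psh R Y) (U : Opens Y) (y : Y) (hy : y ∈ U) (s : G.obj (op U)) :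
    G.germ U y hy s = 0 ↔ ∃ (V : Opens Y) (_ : y ∈ V) (i : V ⟶ U), G.map i.op s = 0 := by
  constructor
  · intro h
    obtain ⟨W, hW, i, j, e⟩ := TopCat.Presheaf.germ_eq G y (U := U) (V := U) hy hy s 0
      (h.trans (map_zero _).symm)
    exact ⟨W, hW, i, e.trans (map_zero _)⟩
  · rintro ⟨V, hV, i, e⟩
    rw [← TopCat.Presheaf.germ_res_apply G i y hV s, e, map_zero]

/-! ### Direct images along closed separating maps. -/

section

variable {f : Y ⟶ X} (hf : IsClosedSeparating f) {F : Psh R X} {G : Psh R Y}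
  {k : F ⟶ (TopCat.Presheaf.pushforward _ f).obj G}
  (hk : ∀ U, Function.Bijective (k.app (op U))) (hG : IsDisjointAdditive G)

include hf hk hG

/-- Injectivity of F_x → ∏ G_y over the fibre. The section vanishes on small disjoint neighbourhoods
of the fibre points, hence on their union, and this union contains the preimage of a neighbourhood
of x. -/
theorem germ_eq_zero_of_fibre (U : Opens X) (x : X) (hx : x ∈ U) (s : F.obj (op U))
    (hs : ∀ y (hy : f y ∈ U), f y = x → G.germ ((Opens.map f).obj U) y hy (k.app (op U) s) = 0) :
    F.germ U x hx s = 0 := by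
  obtain ⟨V, hyV, hV⟩ := hf.exists_disjoint x
  have hyU : ∀ y : {y // f y = x}, f y.1 ∈ U := fun y => by rw [y.2]; exact hx
  choose V' hV' i hi using fun y : {y // f y = x} =>
    (germ_eq_zero_iff G _ _ _ _).1 (hs y.1 (hyU y) y.2)
  obtain ⟨W, hxW, hW⟩ := hf.exists_nhds x (iSup fun y => V y ⊓ V' y) fun y hy =>
    Opens.mem_iSup.2 ⟨⟨y, hy⟩, hyV _, hV' _⟩
  have hle : (⨆ y, V y ⊓ V' y) ≤ (Opens.map f).obj U :=
    iSup_le fun y => inf_le_right.trans (i y).le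
  have h0 : G.map (homOfLE hle).op (k.app (op U) s) = 0 := by
    refine (hG _ (fun y => V y ⊓ V' y) (fun a b hab => (hV hab).mono inf_le_left inf_le_left)
      (fun _ => 0)).unique (fun y => ?_) (fun y => map_zero _)
    have h1 := congrArg (G.map (homOfLE (inf_le_right : V y ⊓ V' y ≤ V' y)).op) (hi y)
    rw [map_zero, ← ConcreteCategory.comp_apply, ← Functor.map_comp] at h1
    refine Eq.trans ?_ h1
    rw [← ConcreteCategory.comp_apply, ← Functor.map_comp]
    rfl
  refine (germ_eq_zero_iff F U x hx s).2 ⟨W ⊓ U, ⟨hxW, hx⟩, homOfLE inf_le_right, ?_⟩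
  refine (hk _).1 (Eq.trans ?_ (map_zero _).symm)
  have h2 : k.app (op (W ⊓ U)) (F.map (homOfLE inf_le_right).op s) =
      G.map (homOfLE (fun y hy => hy.2 : (Opens.map f).obj (W ⊓ U) ≤ (Opens.map f).obj U)).op
        (k.app (op U) s) :=
    congrArg (fun m => m s) (k.naturality (homOfLE inf_le_right : W ⊓ U ⟶ U).op)
  have h3 := congrArg (G.map (homOfLE (fun y hy => hW hy.1 :
    (Opens.map f).obj (W ⊓ U) ≤ ⨆ y, V y ⊓ V' y)).op) h0
  rw [map_zero, ← ConcreteCategory.comp_apply, ← Functor.map_comp] at h3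
  exact h2.trans h3

/-- Surjectivity of F_x → ∏ G_y over the fibre: representatives of the germs live on disjoint open
sets, glue there, and restrict to the preimage of a neighbourhood of x. -/
theorem exists_section_of_fibre (x : X) (b : ∀ y : Y, G.stalk y) :
    ∃ (U : Opens X) (_ : x ∈ U) (s : F.obj (op U)), ∀ y (hy : f y ∈ U), f y = x →
      G.germ ((Opens.map f).obj U) y hy (k.app (op U) s) = b y := by
  obtain ⟨V, hyV, hV⟩ := hf.exists_disjoint x
  choose V' hV' t ht using fun y : Y => stalk_exists_germ G y (b y)
  obtain ⟨W, hxW, hW⟩ := hf.exists_nhds x (iSup fun y => V y ⊓ V' y.1) fun y hy =>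
    Opens.mem_iSup.2 ⟨⟨y, hy⟩, hyV _, hV' _⟩
  obtain ⟨r, hr, -⟩ := hG _ (fun y => V y ⊓ V' y.1)
    (fun a b hab => (hV hab).mono inf_le_left inf_le_left)
    (fun y => G.map (homOfLE inf_le_right).op (t y.1))
  obtain ⟨s, hs⟩ := (hk W).2 (G.map (homOfLE hW).op r)
  refine ⟨W, hxW, s, fun y hy hyx => ?_⟩
  rw [hs]
  have hy' : y ∈ V ⟨y, hyx⟩ ⊓ V' y := ⟨hyV ⟨y, hyx⟩, hV' y⟩
  have h1 := TopCat.Presheaf.germ_res_apply G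
    (homOfLE (le_iSup (fun y : {y // f y = x} => V y ⊓ V' y.1) ⟨y, hyx⟩)) y hy' r
  have h2 := TopCat.Presheaf.germ_res_apply G
    (homOfLE (inf_le_right : V ⟨y, hyx⟩ ⊓ V' y ≤ V' y)) y hy' (t y)
  refine (TopCat.Presheaf.germ_res_apply G (homOfLE hW) y hy r).trans (h1.symm.trans ?_)
  rw [hr ⟨y, hyx⟩]
  exact h2.trans (ht y)

/-- Both sides are products of stalks, and the stalk of F at x is the product of the stalks of G
over the fibre at x. -/
theorem godementMap_bijective (U : Opens X) :
    Function.Bijective ((godementMap f k).app (op U)) := by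
  constructor
  · refine (injective_iff_map_eq_zero _).2 fun s hs => funext fun x => ?_
    obtain ⟨W, hx, a, ha⟩ := stalk_exists_germ F x.1 (s x)
    refine ha.symm.trans (germ_eq_zero_of_fibre hf hk hG W x.1 hx a fun y hy hyx => ?_)
    have hyU : f y ∈ U := by rw [hyx]; exact x.2
    obtain rfl : x = ⟨f y, hyU⟩ := Subtype.ext hyx.symm
    rw [← stalkMap_germ, ha]
    exact congrFun hs ⟨y, hyU⟩
  · intro b
    classical
    -- The family b is extended by zero outside the preimage of U; only its values on fibres over
    -- points of U are used.
    choose W hW s hs using fun x => exists_section_of_fibre hf hk hG x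
      (fun y => if hy : y ∈ (Opens.map f).obj U then b ⟨y, hy⟩ else 0)
    refine ⟨fun x => F.germ (W x.1) x.1 (hW x.1) (s x.1), funext fun y => ?_⟩
    refine (stalkMap_germ f k (W (f y.1)) y.1 (hW _) (s (f y.1))).trans ?_
    refine (hs (f y.1) y.1 (hW _) rfl).trans ?_
    exact dif_pos y.2

theorem cokerMap_bijective (U : Opens X) :
    Function.Bijective ((cokerMap f k).app (op U)) := by
  constructor
  · refine (injective_iff_map_eq_zero _).2 fun s hs => ?_
    obtain ⟨s, rfl⟩ := Submodule.Quotient.mk_surjective _ s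
    obtain ⟨r, hr⟩ := (Submodule.Quotient.mk_eq_zero _).1 hs
    obtain ⟨q, rfl⟩ := (hk U).2 r
    refine (Submodule.Quotient.mk_eq_zero _).2 ⟨q, (godementMap_bijective hf hk hG U).1 ?_⟩
    exact (congrArg (fun m => m.app (op U) q) (toGodement_map f k)).trans hr
  · intro b
    obtain ⟨b, rfl⟩ := Submodule.Quotient.mk_surjective _ b
    obtain ⟨s, rfl⟩ := (godementMap_bijective hf hk hG U).2 b
    exact ⟨Submodule.Quotient.mk s, rfl⟩

theorem iterCokerMap_bijective : ∀ (n : ℕ) (U : Opens X),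
    Function.Bijective ((iterCokerMap f k n).app (op U))
  | 0 => hk
  | n + 1 => cokerMap_bijective hf (iterCokerMap_bijective n) (hG.iterCoker n)

theorem support_subset_image (s : F.obj (op ⊤)) :
    support F s ⊆ f '' support G (k.app (op ⊤) s) := by
  intro x hx
  by_contra h
  refine hx (germ_eq_zero_of_fibre hf hk hG ⊤ x trivial s fun y hy hyx => ?_)
  by_contra hne
  exact h ⟨y, hne, hyx⟩

/-- The map of complexes is already an isomorphism in each degree. Surjectivity with supports uses
that the support of a section downstairs lies in the image of the support of its counterpart
upstairs, and that such images belong to Φ. -/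
theorem isIso_cohomologyMap {Φ : SupportFamily X} {Φ' : SupportFamily Y}
    (hΦ : ∀ Z ∈ Φ.sets, f ⁻¹' Z ∈ Φ'.sets) (hΦ' : ∀ Z ∈ Φ'.sets, f '' Z ∈ Φ.sets) (i : ℤ) :
    IsIso (cohomologyMap f hΦ k i) := by
  have h : ∀ n, IsIso ((cochainsMap f hΦ k).f n) := fun n => by
    have hb := godementMap_bijective hf (iterCokerMap_bijective hf hk hG n) (hG.iterCoker n)
    refine (ConcreteCategory.isIso_iff_bijective (sectionsMap f hΦ _)).2 ?_
    refine ⟨fun a b hab => Subtype.ext ((hb ⊤).1 (congrArg Subtype.val hab)), fun b => ?_⟩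
    obtain ⟨s, hs⟩ := (hb ⊤).2 b.1
    have hsup := support_subset_image hf hb (isDisjointAdditive_godement _) s
    refine ⟨⟨s, Φ.subset_mem _ (hΦ' _ b.2) _ (isClosed_support _ s) ?_⟩, Subtype.ext hs⟩
    rw [hs] at hsup
    exact hsup
  have := HomologicalComplex.Hom.isIso_of_components (cochainsMap f hΦ k)
  exact inferInstanceAs (IsIso ((HomologicalComplex.homologyFunctor _ _ i).map
    ((ComplexShape.embeddingUpNat.extendFunctor (ModuleCat.{v} R)).map (cochainsMap f hΦ k))))

end

/-! ### Formal properties of the push-forward: base change, transitivity, pullback and trace. -/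

theorem map_map_of_inverse (H : Psh R X) {U V : Opens X} (i : U ⟶ V) (j : V ⟶ U)
    (s : H.obj (op V)) : H.map j.op (H.map i.op s) = s := by
  rw [← ConcreteCategory.comp_apply, ← Functor.map_comp,
    Subsingleton.elim (i.op ≫ j.op) (𝟙 (op V)), H.map_id]
  rfl

theorem isComp_id_left (f : Y ⟶ X) {F F' : Psh R X} {G : Psh R Y} (a : F ⟶ F')
    (k : F' ⟶ (TopCat.Presheaf.pushforward _ f).obj G) :
    IsComp (𝟙 X) f f (Category.comp_id f).symm (a ≫ (TopCat.Presheaf.Pushforward.id F').inv) k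
      (a ≫ k) := fun U s =>
  (congrArg (fun q => q ((a ≫ k).app (op U) s)) (G.map_id (op ((Opens.map f).obj U)))).symm

theorem isComp_id_right (f : Y ⟶ X) {F : Psh R X} {G G' : Psh R Y}
    (k : F ⟶ (TopCat.Presheaf.pushforward _ f).obj G) (a : G ⟶ G') :
    IsComp f (𝟙 Y) f (Category.id_comp f).symm k (a ≫ (TopCat.Presheaf.Pushforward.id G').inv)
      (k ≫ (TopCat.Presheaf.pushforward _ f).map a) := fun U s =>
  (congrArg (fun q => q (a.app (op ((Opens.map f).obj U)) (k.app (op U) s)))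
    (G'.map_id (op ((Opens.map f).obj U)))).symm

/-- The map on cohomology induced by a morphism of presheaves on `X`. -/
abbrev coefficientMap (Φ : SupportFamily X) {F F' : Psh R X} (a : F ⟶ F') (i : ℤ) :
    cohomology Φ F i ⟶ cohomology Φ F' i :=
  cohomologyMap (Φ := Φ) (Φ' := Φ) (𝟙 X) (fun _ hZ => hZ)
    (a ≫ (TopCat.Presheaf.Pushforward.id F').inv) i

variable {Φ : SupportFamily X} {Φ' : SupportFamily Y} {Φ'' : SupportFamily Z}

theorem coefficientMap_comp_cohomologyMap (f : Y ⟶ X) (hf : ∀ Z ∈ Φ.sets, f ⁻¹' Z ∈ Φ'.sets)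
    {F F' : Psh R X} {G : Psh R Y} (a : F ⟶ F')
    (k : F' ⟶ (TopCat.Presheaf.pushforward _ f).obj G) (i : ℤ) :
    coefficientMap Φ a i ≫ cohomologyMap f hf k i = cohomologyMap f hf (a ≫ k) i :=
  cohomologyMap_comp _ _ hf hf (isComp_id_left f a k) i

theorem cohomologyMap_comp_coefficientMap (f : Y ⟶ X) (hf : ∀ Z ∈ Φ.sets, f ⁻¹' Z ∈ Φ'.sets)
    {F : Psh R X} {G G' : Psh R Y} (k : F ⟶ (TopCat.Presheaf.pushforward _ f).obj G)
    (a : G ⟶ G') (i : ℤ) :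
    cohomologyMap f hf k i ≫ coefficientMap Φ' a i =
      cohomologyMap f hf (k ≫ (TopCat.Presheaf.pushforward _ f).map a) i :=
  cohomologyMap_comp _ hf _ hf (isComp_id_right f k a) i

theorem coefficientMap_comp {F F' F'' : Psh R X} (a : F ⟶ F') (b : F' ⟶ F'') (i : ℤ) :
    coefficientMap Φ a i ≫ coefficientMap Φ b i = coefficientMap Φ (a ≫ b) i :=
  (coefficientMap_comp_cohomologyMap (𝟙 X) (fun _ hZ => hZ) a _ i).trans
    (by rw [coefficientMap, Category.assoc])

/-- The canonical map `H^i_Φ(X, f_* G) ⟶ H^i_Φ'(Y, G)`. -/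
abbrev directImageMap (f : Y ⟶ X) (hf : ∀ Z ∈ Φ.sets, f ⁻¹' Z ∈ Φ'.sets) (G : Psh R Y) (i : ℤ) :
    cohomology Φ ((TopCat.Presheaf.pushforward _ f).obj G) i ⟶ cohomology Φ' G i :=
  cohomologyMap (Φ := Φ) (Φ' := Φ') f hf (𝟙 ((TopCat.Presheaf.pushforward _ f).obj G)) i

theorem coefficientMap_directImageMap (f : Y ⟶ X) (hf : ∀ Z ∈ Φ.sets, f ⁻¹' Z ∈ Φ'.sets)
    {F : Psh R X} {G : Psh R Y} (k : F ⟶ (TopCat.Presheaf.pushforward _ f).obj G) (i : ℤ) :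
    coefficientMap Φ k i ≫ directImageMap f hf G i = cohomologyMap f hf k i := by
  rw [coefficientMap_comp_cohomologyMap, Category.comp_id]

theorem directImageMap_cohomologyPush (f : Y ⟶ X) (hf : ∀ Z ∈ Φ.sets, f ⁻¹' Z ∈ Φ'.sets)
    {F : Psh R X} {G : Psh R Y} (tr : (TopCat.Presheaf.pushforward _ f).obj G ⟶ F) (i : ℤ)
    (h : IsIso (directImageMap (Φ := Φ) (Φ' := Φ') f hf G i)) :
    directImageMap f hf G i ≫ cohomologyPush f hf tr i = coefficientMap Φ tr i := by
  rw [cohomologyPush, dif_pos h, IsIso.hom_inv_id_assoc]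

/-- The pullback followed by the push-forward. -/
theorem cohomologyMap_comp_push (f : Y ⟶ X) (hf : ∀ Z ∈ Φ.sets, f ⁻¹' Z ∈ Φ'.sets)
    {F F' : Psh R X} {G : Psh R Y} (k : F ⟶ (TopCat.Presheaf.pushforward _ f).obj G)
    (tr : (TopCat.Presheaf.pushforward _ f).obj G ⟶ F') (i : ℤ)
    (h : IsIso (directImageMap (Φ := Φ) (Φ' := Φ') f hf G i)) :
    cohomologyMap f hf k i ≫ cohomologyPush f hf tr i = coefficientMap Φ (k ≫ tr) i := by
  rw [← coefficientMap_directImageMap, Category.assoc, directImageMap_cohomologyPush f hf tr i h,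
    coefficientMap_comp]

/-- Base change for the push-forward. -/
theorem cohomologyPush_comp_map {X' Y' : TopCat.{v}} {Ψ : SupportFamily X'} {Ψ' : SupportFamily Y'}
    (f : Y ⟶ X) (f' : Y' ⟶ X') (g : X' ⟶ X) (g' : Y' ⟶ Y) (e : g' ≫ f = f' ≫ g)
    (hf : ∀ Z ∈ Φ.sets, f ⁻¹' Z ∈ Φ'.sets) (hf' : ∀ Z ∈ Ψ.sets, f' ⁻¹' Z ∈ Ψ'.sets)
    (hg : ∀ Z ∈ Φ.sets, g ⁻¹' Z ∈ Ψ.sets) (hg' : ∀ Z ∈ Φ'.sets, g' ⁻¹' Z ∈ Ψ'.sets)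
    {F : Psh R X} {G : Psh R Y} {F' : Psh R X'} {G' : Psh R Y'}
    (tr : (TopCat.Presheaf.pushforward _ f).obj G ⟶ F)
    (tr' : (TopCat.Presheaf.pushforward _ f').obj G' ⟶ F')
    (k : F ⟶ (TopCat.Presheaf.pushforward _ g).obj F')
    (l : G ⟶ (TopCat.Presheaf.pushforward _ g').obj G')
    (hkl : ∀ (U : Opens X) (s : G.obj (op ((Opens.map f).obj U))),
      k.app (op U) (tr.app (op U) s) = tr'.app (op ((Opens.map g).obj U))
        (G'.map (eqToHom (congrArg (fun q => (Opens.map q).obj U) e.symm) :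
            (Opens.map f').obj ((Opens.map g).obj U) ⟶ (Opens.map g').obj ((Opens.map f).obj U)).op
          (l.app (op ((Opens.map f).obj U)) s)))
    (i : ℤ) (h : IsIso (directImageMap (Φ := Φ) (Φ' := Φ') f hf G i))
    (h' : IsIso (directImageMap (Φ := Ψ) (Φ' := Ψ') f' hf' G' i)) :
    cohomologyPush f hf tr i ≫ cohomologyMap g hg k i =
      cohomologyMap g' hg' l i ≫ cohomologyPush f' hf' tr' i := by
  have e' : ∀ U : Opens X, (Opens.map f').obj ((Opens.map g).obj U) =
      (Opens.map g').obj ((Opens.map f).obj U) :=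
    fun U => congrArg (fun q => (Opens.map q).obj U) e.symm
  -- The map l, read over X: it goes from f_*G to g_*f'_*G', which has the same sections as (g' ≫
  -- f)_*G' up to the equality of the two composites.
  let l' : (TopCat.Presheaf.pushforward _ f).obj G ⟶
      (TopCat.Presheaf.pushforward _ g).obj ((TopCat.Presheaf.pushforward _ f').obj G') :=
    { app := fun U => l.app (op ((Opens.map f).obj U.unop)) ≫ G'.map (eqToHom (e' U.unop)).op
      naturality := fun U V j => by
        have h1 := l.naturality ((Opens.map f).map j.unop).op
        refine (Category.assoc _ _ _).symm.trans
          ((congrArg (fun q => q ≫ G'.map (eqToHom (e' V.unop)).op) h1).trans ?_)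
        refine (Category.assoc _ _ _).trans (Eq.trans ?_ (Category.assoc _ _ _).symm)
        refine congrArg (fun q => l.app (op ((Opens.map f).obj U.unop)) ≫ q) ?_
        exact (G'.map_comp _ _).symm.trans ((congrArg G'.map (Subsingleton.elim _ _)).trans
          (G'.map_comp _ _)) }
  have hfg : ∀ Z ∈ Φ.sets, (g' ≫ f) ⁻¹' Z ∈ Ψ'.sets := fun Z hZ => hg' _ (hf _ hZ)
  have h1 : directImageMap f hf G i ≫ cohomologyMap g' hg' l i =
      cohomologyMap (g' ≫ f) hfg ((TopCat.Presheaf.pushforward _ f).map l) i :=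
    cohomologyMap_comp rfl hf hg' hfg (isComp_iff.2 fun _ _ => rfl) i
  have h2 : cohomologyMap g hg l' i ≫ directImageMap f' hf' G' i =
      cohomologyMap (g' ≫ f) hfg ((TopCat.Presheaf.pushforward _ f).map l) i :=
    cohomologyMap_comp e hg hf' hfg (fun U s => (map_map_of_inverse G' _ _ _).symm) i
  -- Precomposition with the isomorphism from the cohomology of f_*G removes both inverses; what is
  -- left is an identity of morphisms of presheaves on X.
  rw [← cancel_epi (directImageMap (Φ := Φ) (Φ' := Φ') f hf G i), ← Category.assoc,
    directImageMap_cohomologyPush f hf tr i h, coefficientMap_comp_cohomologyMap,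
    ← Category.assoc, h1, ← h2, Category.assoc, directImageMap_cohomologyPush f' hf' tr' i h',
    cohomologyMap_comp_coefficientMap]
  refine congrArg (fun q => cohomologyMap g hg q i) ?_
  ext U s
  exact hkl U s

/-- Transitivity of the push-forward. -/
theorem cohomologyPush_comp (f : Y ⟶ X) (g : Z ⟶ Y) (h : Z ⟶ X) (e : h = g ≫ f)
    (hf : ∀ Z ∈ Φ.sets, f ⁻¹' Z ∈ Φ'.sets) (hg : ∀ Z ∈ Φ'.sets, g ⁻¹' Z ∈ Φ''.sets)
    (hh : ∀ Z ∈ Φ.sets, h ⁻¹' Z ∈ Φ''.sets) {F : Psh R X} {G : Psh R Y} {H : Psh R Z}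
    (trf : (TopCat.Presheaf.pushforward _ f).obj G ⟶ F)
    (trg : (TopCat.Presheaf.pushforward _ g).obj H ⟶ G)
    (trh : (TopCat.Presheaf.pushforward _ h).obj H ⟶ F)
    (htr : ∀ (U : Opens X) (s : H.obj (op ((Opens.map h).obj U))),
      trh.app (op U) s = trf.app (op U) (trg.app (op ((Opens.map f).obj U))
        (H.map (eqToHom (by rw [e]; rfl) :
          (Opens.map g).obj ((Opens.map f).obj U) ⟶ (Opens.map h).obj U).op s)))
    (i : ℤ) (If : IsIso (directImageMap (Φ := Φ) (Φ' := Φ') f hf G i))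
    (Ig : IsIso (directImageMap (Φ := Φ') (Φ' := Φ'') g hg H i))
    (Ih : IsIso (directImageMap (Φ := Φ) (Φ' := Φ'') h hh H i)) :
    cohomologyPush g hg trg i ≫ cohomologyPush f hf trf i = cohomologyPush h hh trh i := by
  subst e
  -- The presheaves (g ≫ f)_*H and f_*g_*H have the same sections; c is the identity between them,
  -- retained only through its effect on sections.
  obtain ⟨c, hc⟩ : ∃ c : (TopCat.Presheaf.pushforward _ (g ≫ f)).obj H ⟶
      (TopCat.Presheaf.pushforward _ f).obj ((TopCat.Presheaf.pushforward _ g).obj H),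
      ∀ (U : Opens X) (s : H.obj (op ((Opens.map (g ≫ f)).obj U))), c.app (op U) s = s :=
    ⟨𝟙 _, fun _ _ => rfl⟩
  have h1 : cohomologyMap f hf c i ≫ directImageMap g hg H i = directImageMap (g ≫ f) hh H i :=
    cohomologyMap_comp rfl hf hg hh (isComp_iff.2 fun U s => (hc U s).symm) i
  rw [← cancel_epi (directImageMap (Φ := Φ) (Φ' := Φ'') (g ≫ f) hh H i),
    directImageMap_cohomologyPush (g ≫ f) hh trh i Ih, ← h1, Category.assoc,
    ← Category.assoc (directImageMap g hg H i), directImageMap_cohomologyPush g hg trg i Ig,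
    ← Category.assoc (cohomologyMap f hf c i), cohomologyMap_comp_coefficientMap,
    cohomologyMap_comp_push f hf _ trf i If]
  refine congrArg (fun q => coefficientMap Φ q i) ?_
  ext U s
  refine Eq.trans ?_ (htr U s).symm
  refine congrArg (fun q => trf.app (op U) (trg.app (op ((Opens.map f).obj U)) q)) ?_
  exact (hc U s).trans (congrArg (fun q => q s) (H.map_id _)).symm

theorem coefficientMap_nsmul {F : Psh R X} (m : ℕ) (i : ℤ) :
    coefficientMap Φ (m • 𝟙 F) i = m • coefficientMap Φ (𝟙 F) i := by
  refine Eq.trans ?_ (cohomologyMap_nsmul (𝟙 X) (fun _ hZ => hZ) m _ i)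
  refine congrArg (fun q => cohomologyMap (Φ := Φ) (Φ' := Φ) (𝟙 X) (fun _ hZ => hZ) q i) ?_
  exact Preadditive.nsmul_comp _ _ _

/-- If the composition of the pullback and the trace is multiplication by `m`, so is the composition
of the pullback and the push-forward; here after a pullback. -/
theorem cohomologyMap_comp_map_comp_push {W : TopCat.{v}} {Ψ : SupportFamily W}
    (p : X ⟶ W) (hp : ∀ Z ∈ Ψ.sets, p ⁻¹' Z ∈ Φ.sets)
    (f : Y ⟶ X) (hf : ∀ Z ∈ Φ.sets, f ⁻¹' Z ∈ Φ'.sets)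
    {E : Psh R W} {F : Psh R X} {G : Psh R Y} (r : E ⟶ (TopCat.Presheaf.pushforward _ p).obj F)
    (k : F ⟶ (TopCat.Presheaf.pushforward _ f).obj G)
    (tr : (TopCat.Presheaf.pushforward _ f).obj G ⟶ F) (m : ℕ) (hm : k ≫ tr = m • 𝟙 F) (i : ℤ)
    (h : IsIso (directImageMap (Φ := Φ) (Φ' := Φ') f hf G i)) :
    cohomologyMap p hp r i ≫ cohomologyMap f hf k i ≫ cohomologyPush f hf tr i =
      m • cohomologyMap p hp r i := by
  rw [cohomologyMap_comp_push f hf k tr i h, hm, coefficientMap_nsmul, Preadditive.comp_nsmul,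
    cohomologyMap_comp_coefficientMap, CategoryTheory.Functor.map_id, Category.comp_id]

end SupportCohomology
end

noncomputable section

/-! ### Discreteness of ℚ in the adeles and closedness of the rational points. -/

namespace AdelicGroup

open CategoryTheory TopologicalSpace Opposite SupportCohomology IsDedekindDomain

theorem t1Space_finAdele : T1Space FinAdele :=
  inferInstanceAs (T1Space (RestrictedProduct
    (fun v : HeightOneSpectrum ℤ => v.adicCompletion ℚ)
    (fun v => (v.adicCompletionIntegers ℚ : Set (v.adicCompletion ℚ))) Filter.cofinite))

theorem isOpen_integral : IsOpen {a : FinAdele | ∀ v, a v ∈ v.adicCompletionIntegers ℚ} :=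
  RestrictedProduct.isOpen_forall_mem
    (R := fun v : HeightOneSpectrum ℤ => v.adicCompletion ℚ)
    (A := fun v => (v.adicCompletionIntegers ℚ : Set (v.adicCompletion ℚ)))
    fun _ => Valued.isOpen_valuationSubring _

/-- The diagonal embedding of `ℚ` in the adeles. -/
def diagonal (q : ℚ) : ℝ × FinAdele := (algebraMap ℚ ℝ q, algebraMap ℚ FinAdele q)

/-- A rational number that is integral at all finite places is an integer, and an integer of
absolute value below 1 is zero. -/
theorem eq_of_integral_sub (q r : ℚ) (h : |(q : ℝ) - r| < 1)
    (h' : ∀ v : HeightOneSpectrum ℤ, (algebraMap ℚ FinAdele q - algebraMap ℚ FinAdele r) v ∈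
      v.adicCompletionIntegers ℚ) : q = r := by
  obtain ⟨z, hz⟩ := HeightOneSpectrum.mem_integers_of_valuation_le_one (R := ℤ) ℚ (q - r)
    fun v => by
      have h1 := h' v
      rw [← map_sub, FiniteAdeleRing.algebraMap_apply, HeightOneSpectrum.mem_adicCompletionIntegers,
        HeightOneSpectrum.valuedAdicCompletion_eq_valuation'] at h1
      exact h1
  have hz' : ((z : ℚ) : ℝ) = (q : ℝ) - r := by
    rw [← Rat.cast_sub, ← hz]
    rfl
  rw [← hz'] at h
  have h0 : z = 0 := Int.abs_lt_one_iff.1 (by exact_mod_cast h)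
  rw [h0, map_zero] at hz
  exact (sub_eq_zero.1 hz.symm)

theorem isClosed_range_diagonal : IsClosed (Set.range diagonal) := by
  have := t1Space_finAdele
  refine isClosed_of_closure_subset fun p hp => ?_
  -- The radius 1/2 makes two rationals in U differ by less than 1 at the real place; their
  -- difference is integral at the finite places, so U contains at most one rational.
  let U : Set (ℝ × FinAdele) :=
    {x | |x.1 - p.1| < 1 / 2} ∩
      {x | x.2 - p.2 ∈ {a : FinAdele | ∀ v, a v ∈ v.adicCompletionIntegers ℚ}}
  have hU : IsOpen U := by
    refine IsOpen.inter ?_ (isOpen_integral.preimage (by fun_prop))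
    exact isOpen_lt (by fun_prop) continuous_const
  have hpU : p ∈ U := by
    refine ⟨by simp, fun v => ?_⟩
    rw [sub_self]
    exact zero_mem _
  obtain ⟨_, hq, q, rfl⟩ := mem_closure_iff.1 hp U hU hpU
  -- If p is not rational, removing q from U leaves a neighbourhood of p, which must contain a
  -- second rational.
  by_contra hne
  obtain ⟨_, ⟨hr, hrq⟩, r, rfl⟩ := mem_closure_iff.1 hp (U \ {diagonal q})
    (hU.sdiff isClosed_singleton) ⟨hpU, fun h => hne ⟨q, h.symm⟩⟩
  refine hrq (congrArg diagonal (eq_of_integral_sub r q ?_ fun v => ?_))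
  · have h1 : |(r : ℝ) - p.1| < 1 / 2 := hr.1
    have h2 : |(q : ℝ) - p.1| < 1 / 2 := hq.1
    rw [abs_lt] at *
    constructor <;> linarith [h1.1, h1.2, h2.1, h2.2]
  · have h1 := sub_mem (hr.2 v) (hq.2 v)
    have h2 : algebraMap ℚ FinAdele r - algebraMap ℚ FinAdele q =
        (algebraMap ℚ FinAdele r - p.2) - (algebraMap ℚ FinAdele q - p.2) := by ring
    rw [h2]
    exact h1

variable {n : ℕ} (G : LinearAlgebraicGroup n)

/-- The diagonal embedding of `G(ℚ)` in `G(ℝ) × G(𝔸^∞)`. -/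
def rationalDiagonal (γ : G.points ℚ) : G.points ℝ × G.points FinAdele :=
  (G.rationalPoints ℝ γ, G.rationalPoints FinAdele γ)

/-- Rationality can be tested on entries: the determinant of the rational matrix is nonzero because
its real image is a unit, and the equations of G descend along the injection ℚ → ℝ. Closedness of
G(ℚ) is thereby reduced to that of ℚ in the adeles. -/
theorem mem_range_rationalDiagonal_iff (p : G.points ℝ × G.points FinAdele) :
    p ∈ Set.range (rationalDiagonal G) ↔
      ∀ i j, (p.1.1.1 i j, p.2.1.1 i j) ∈ Set.range diagonal := by
  constructor
  · rintro ⟨γ, rfl⟩ i j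
    exact ⟨γ.1.1 i j, rfl⟩
  · intro h
    choose A hA using h
    have hR : (Matrix.of A).map (algebraMap ℚ ℝ) = p.1.1.1 := by
      ext i j
      exact congrArg Prod.fst (hA i j)
    have hF : (Matrix.of A).map (algebraMap ℚ FinAdele) = p.2.1.1 := by
      ext1 i j
      exact congrArg Prod.snd (hA i j)
    have hdet : (Matrix.of A).det ≠ 0 := fun h0 => by
      have h1 := (Matrix.isUnit_iff_isUnit_det _).1 p.1.1.isUnit
      rw [← hR, ← RingHom.mapMatrix_apply, ← RingHom.map_det, h0, map_zero] at h1
      exact not_isUnit_zero h1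
    let g : GL (Fin n) ℚ := Matrix.GeneralLinearGroup.mkOfDetNeZero (Matrix.of A) hdet
    have hg : g ∈ G.points ℚ := fun P hP => by
      refine (algebraMap ℚ ℝ).injective ?_
      rw [map_zero, ← MvPolynomial.aeval_algebraMap_apply]
      refine Eq.trans ?_ (p.1.2 P hP)
      refine congrArg (fun x => MvPolynomial.aeval x P) (funext fun ij => ?_)
      exact congrFun (congrFun hR ij.1) ij.2
    exact ⟨⟨g, hg⟩, Prod.ext (Subtype.ext (Units.ext hR)) (Subtype.ext (Units.ext hF))⟩

theorem isClosed_range_rationalDiagonal : IsClosed (Set.range (rationalDiagonal G)) := by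
  have h : Set.range (rationalDiagonal G) = ⋂ i, ⋂ j,
      (fun p : G.points ℝ × G.points FinAdele => (p.1.1.1 i j, p.2.1.1 i j)) ⁻¹'
        Set.range diagonal := by
    ext p
    simpa only [Set.mem_iInter, Set.mem_preimage] using mem_range_rationalDiagonal_iff G p
  rw [h]
  refine isClosed_iInter fun i => isClosed_iInter fun j => isClosed_range_diagonal.preimage ?_
  have h1 : ∀ (B : Type) [CommRing B] [TopologicalSpace B] [IsTopologicalRing B] [Algebra ℚ B],
      Continuous fun g : G.points B => g.1.1 i j := fun B _ _ _ _ =>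
    (Units.continuous_val.comp continuous_subtype_val).matrix_elem i j
  exact ((h1 ℝ).comp continuous_fst).prodMk ((h1 FinAdele).comp continuous_snd)

/-! ### The quotients S_K as Hausdorff spaces. -/

variable {G} {Kinf : Subgroup (G.points ℝ)}

theorem proj_eq_iff (K : Level G Kinf) (y y' : AdelicCoset G Kinf) :
    proj.{v} K y = proj K y' ↔ ∃ (γ : G.points ℚ), ∃ k ∈ K.toSubgroup, y' = (y.mul k).act γ := by
  constructor
  · intro h
    obtain ⟨k, hk, h1⟩ := Quotient.exact (s := levelSetoid K) (congrArg ULift.down h)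
    obtain ⟨γ, h2⟩ := Quotient.exact (s := rationalSetoid G Kinf) h1
    exact ⟨γ, k, hk, h2.symm⟩
  · rintro ⟨γ, k, hk, rfl⟩
    rw [proj_act, proj_mul K y hk]

theorem isOpenQuotientMap_mk_rational :
    IsOpenQuotientMap (Quotient.mk (rationalSetoid G Kinf)) where
  surjective := Quotient.mk_surjective
  continuous := continuous_quotient_mk'
  isOpenMap U hU := by
    have h : Quotient.mk (rationalSetoid G Kinf) ⁻¹' (Quotient.mk (rationalSetoid G Kinf) '' U) =
        ⋃ γ : G.points ℚ, AdelicCoset.act γ ⁻¹' U := by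
      ext y
      simp only [Set.mem_preimage, Set.mem_image, Set.mem_iUnion]
      constructor
      · rintro ⟨z, hz, h⟩
        obtain ⟨γ, h1⟩ := Quotient.exact (s := rationalSetoid G Kinf) h.symm
        exact ⟨γ, by rw [h1]; exact hz⟩
      · rintro ⟨γ, hγ⟩
        exact ⟨_, hγ, (Quotient.sound (s := rationalSetoid G Kinf) ⟨γ, rfl⟩).symm⟩
    refine isQuotientMap_quotient_mk'.isOpen_preimage.1 ?_
    have hc : ∀ γ : G.points ℚ, Continuous fun y : AdelicCoset G Kinf =>
        (G.rationalPoints ℝ γ • y.1, G.rationalPoints FinAdele γ * y.2) := fun γ => by fun_prop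
    exact h ▸ isOpen_iUnion fun γ => hU.preimage (hc γ)

theorem isOpenQuotientMap_toSpace (K : Level G Kinf) : IsOpenQuotientMap (toSpace.{v} K) where
  surjective x := by
    obtain ⟨y, hy⟩ := Quotient.mk_surjective (s := levelSetoid K) x.down
    exact ⟨y, congrArg ULift.up hy⟩
  continuous := continuous_toSpace K
  isOpenMap U hU := by
    refine Homeomorph.ulift.symm.isOpenMap.comp (f := Quotient.mk (levelSetoid K)) ?_ U hU
    intro U hU
    have h : Quotient.mk (levelSetoid K) ⁻¹' (Quotient.mk (levelSetoid K) '' U) =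
        ⋃ k : K.toSubgroup, (fun x => AdelicSpace.mul x k.1) ⁻¹' U := by
      ext y
      simp only [Set.mem_preimage, Set.mem_image, Set.mem_iUnion]
      constructor
      · rintro ⟨z, hz, h⟩
        obtain ⟨k, hk, h1⟩ := Quotient.exact (s := levelSetoid K) h.symm
        exact ⟨⟨k, hk⟩, by rw [h1]; exact hz⟩
      · rintro ⟨k, hk⟩
        exact ⟨_, hk, (Quotient.sound (s := levelSetoid K) ⟨k.1, k.2, rfl⟩).symm⟩
    refine isQuotientMap_quotient_mk'.isOpen_preimage.1 ?_
    exact h ▸ isOpen_iUnion fun k => hU.preimage (AdelicSpace.continuous_mul k.1)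

theorem isOpenQuotientMap_proj (K : Level G Kinf) : IsOpenQuotientMap (proj.{v} K) :=
  (isOpenQuotientMap_toSpace K).comp isOpenQuotientMap_mk_rational

/-- The map `G(ℝ) × G(𝔸^∞) → S_K`. -/
def pointsProj (K : Level G Kinf) (g : G.points ℝ × G.points FinAdele) : space.{v} K :=
  proj K (Prod.map QuotientGroup.mk id g)

theorem isOpenQuotientMap_pointsProj (K : Level G Kinf) : IsOpenQuotientMap (pointsProj.{v} K) :=
  (isOpenQuotientMap_proj K).comp (QuotientGroup.isOpenQuotientMap_mk.prodMap .id)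

/-- The preimage of `K` in `K_∞ × G(𝔸^∞)`. -/
def levelPreimage (K : Level G Kinf) : Set (Kinf × G.points FinAdele) :=
  Prod.map QuotientGroup.mk id ⁻¹' (K.toSubgroup : Set (AdelicNat G Kinf))

/-- It is closed, because the open subgroup K is closed, and it lies in the product of K_∞ with the
compact finite part of K. -/
theorem isCompact_levelPreimage (hKinf : IsCompact (Kinf : Set (G.points ℝ))) (K : Level G Kinf) :
    IsCompact (levelPreimage K) := by
  have : CompactSpace Kinf := isCompact_iff_compactSpace.1 hKinf
  refine (isCompact_univ.prod (K.isCompact.image continuous_snd)).of_isClosed_subset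
    ((Subgroup.isClosed_of_isOpen _ K.isOpen).preimage ?_) ?_
  · exact (continuous_quotient_mk'.comp continuous_fst).prodMk continuous_snd
  · exact fun x hx => ⟨trivial, _, hx, rfl⟩

/-- This form exhibits the equivalence relation as the projection, along the compact set of all k,
of a condition that is closed because G(ℚ) is. -/
theorem pointsProj_eq_iff (K : Level G Kinf) (g h : G.points ℝ × G.points FinAdele) :
    pointsProj.{v} K g = pointsProj K h ↔ ∃ k ∈ levelPreimage K,
      (h.1 * (g.1 * k.1)⁻¹, h.2 * (g.2 * k.2)⁻¹) ∈ Set.range (rationalDiagonal G) := by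
  rw [pointsProj, pointsProj, proj_eq_iff]
  constructor
  · rintro ⟨γ, ⟨k, l⟩, hk, e⟩
    obtain ⟨c, rfl⟩ := QuotientGroup.mk_surjective k
    have e1 : (QuotientGroup.mk (G.rationalPoints ℝ γ * (g.1 * c)) :
        G.points ℝ ⧸ (Subgroup.connectedComponentOfOne Kinf).map Kinf.subtype) =
          QuotientGroup.mk h.1 := (congrArg Prod.fst e).symm
    obtain ⟨d, hd, hd'⟩ := QuotientGroup.eq.1 e1
    have e2 : h.2 = G.rationalPoints FinAdele γ * (g.2 * l) := congrArg Prod.snd e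
    -- The real components agree only modulo K_∞°; the discrepancy d is absorbed into the lift c
    -- without changing its class.
    refine ⟨(c * d, l), ?_, γ, Prod.ext ?_ ?_⟩
    · have h1 : (QuotientGroup.mk (c * d) : Kinf ⧸ Subgroup.connectedComponentOfOne Kinf) =
          QuotientGroup.mk c := (QuotientGroup.mk_mul_of_mem c hd)
      change (QuotientGroup.mk (c * d), l) ∈ K.toSubgroup
      rw [h1]
      exact hk
    · have h2 : (d : G.points ℝ) = (G.rationalPoints ℝ γ * (g.1 * c))⁻¹ * h.1 := hd'
      change G.rationalPoints ℝ γ = h.1 * (g.1 * ((c * d : Kinf) : G.points ℝ))⁻¹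
      rw [Subgroup.coe_mul, h2]
      group
    · change G.rationalPoints FinAdele γ = h.2 * (g.2 * l)⁻¹
      rw [e2, mul_inv_cancel_right]
  · rintro ⟨⟨c, l⟩, hk, γ, e⟩
    have e1 : G.rationalPoints ℝ γ = h.1 * (g.1 * c)⁻¹ := congrArg Prod.fst e
    have e2 : G.rationalPoints FinAdele γ = h.2 * (g.2 * l)⁻¹ := congrArg Prod.snd e
    refine ⟨γ, (QuotientGroup.mk c, l), hk, Prod.ext ?_ ?_⟩
    · change _ = QuotientGroup.mk (G.rationalPoints ℝ γ * (g.1 * c))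
      rw [e1, inv_mul_cancel_right]
      rfl
    · change h.2 = G.rationalPoints FinAdele γ * (g.2 * l)
      rw [e2, inv_mul_cancel_right]

/-- `S_K` is Hausdorff. -/
theorem t2Space_space (hKinf : IsCompact (Kinf : Set (G.points ℝ))) (K : Level G Kinf) :
    T2Space (space.{v} K) := by
  refine (t2Space_iff_of_isOpenQuotientMap (isOpenQuotientMap_pointsProj K)).2 ?_
  have : CompactSpace (levelPreimage K) :=
    isCompact_iff_compactSpace.1 (isCompact_levelPreimage hKinf K)
  -- The relation is the image of the closed set T under a projection with compact fibre factor,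
  -- hence closed; for an open quotient map this means that the quotient is Hausdorff.
  let T : Set (((G.points ℝ × G.points FinAdele) × (G.points ℝ × G.points FinAdele)) ×
      levelPreimage K) :=
    (fun x => (x.1.2.1 * (x.1.1.1 * x.2.1.1)⁻¹, x.1.2.2 * (x.1.1.2 * x.2.1.2)⁻¹)) ⁻¹'
      Set.range (rationalDiagonal G)
  have hT : IsClosed T := (isClosed_range_rationalDiagonal G).preimage (by fun_prop)
  have h : {q : (G.points ℝ × G.points FinAdele) × (G.points ℝ × G.points FinAdele) |
      pointsProj.{v} K q.1 = pointsProj K q.2} = Prod.fst '' T := by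
    ext q
    simp only [Set.mem_ofPred_eq, pointsProj_eq_iff, Set.mem_image]
    constructor
    · rintro ⟨k, hk, h⟩
      exact ⟨(q, ⟨k, hk⟩), h, rfl⟩
    · rintro ⟨x, hx, rfl⟩
      exact ⟨x.2.1, x.2.2, hx⟩
  rw [h]
  exact isClosedMap_fst_of_compactSpace _ hT

/-! ### The finite maps S_{K'} → S_K and their supports. -/

theorem levelMap_eq_toSpace_iff (K K' : Level G Kinf) (h : K'.toSubgroup ≤ K.toSubgroup)
    (z : space.{v} K') (x : AdelicSpace G Kinf) :
    levelMap K K' h z = toSpace K x ↔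
      ∃ c : K.toSubgroup ⧸ K'.toSubgroup.subgroupOf K.toSubgroup,
        z = toSpace K' (AdelicSpace.mul x c.out.1) := by
  constructor
  · intro hz
    obtain ⟨w, rfl⟩ := (isOpenQuotientMap_toSpace K').surjective z
    obtain ⟨k, hk, rfl⟩ := Quotient.exact (s := levelSetoid K)
      (congrArg ULift.down hz.symm : Quotient.mk (levelSetoid K) x = Quotient.mk _ w)
    obtain ⟨m, hm⟩ := QuotientGroup.mk_out_eq_mul (K'.toSubgroup.subgroupOf K.toSubgroup) ⟨k, hk⟩
    refine ⟨QuotientGroup.mk ⟨k, hk⟩, ?_⟩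
    have hm' : m.1.1 ∈ K'.toSubgroup := m.2
    rw [hm]
    exact ((congrArg (toSpace K') (AdelicSpace.mul_mul' x k m.1.1)).trans
      (toSpace_mul K' _ hm')).symm
  · rintro ⟨c, rfl⟩
    exact toSpace_mul K x c.out.2

/-- Pulled back to 𝒳, the image of a closed set is a union of translates indexed by the finite set
K/K', hence closed. The fibres are finite, and finite sets in the Hausdorff space S_{K'} can be
separated. -/
theorem isClosedSeparating_levelMap (hKinf : IsCompact (Kinf : Set (G.points ℝ)))
    (K K' : Level G Kinf) (h : K'.toSubgroup ≤ K.toSubgroup) :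
    IsClosedSeparating (levelMap.{v} K K' h) where
  isClosedMap Z hZ := by
    have e : toSpace K ⁻¹' (levelMap.{v} K K' h '' Z) =
        ⋃ c : K.toSubgroup ⧸ K'.toSubgroup.subgroupOf K.toSubgroup,
          (fun x => toSpace K' (AdelicSpace.mul x c.out.1)) ⁻¹' Z := by
      ext x
      simp only [Set.mem_preimage, Set.mem_image, Set.mem_iUnion]
      constructor
      · rintro ⟨z, hz, hzx⟩
        obtain ⟨c, rfl⟩ := (levelMap_eq_toSpace_iff K K' h z x).1 hzx
        exact ⟨c, hz⟩
      · rintro ⟨c, hc⟩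
        exact ⟨_, hc, (levelMap_eq_toSpace_iff K K' h _ x).2 ⟨c, rfl⟩⟩
    refine (isOpenQuotientMap_toSpace K).isQuotientMap.isClosed_preimage.1 (e ▸ ?_)
    exact isClosed_iUnion_of_finite fun c =>
      hZ.preimage ((continuous_toSpace K').comp (AdelicSpace.continuous_mul _))
  exists_disjoint x := by
    have := t2Space_space.{v} hKinf K'
    obtain ⟨w, rfl⟩ := (isOpenQuotientMap_toSpace K).surjective x
    have hfin : {z : space.{v} K' | levelMap K K' h z = toSpace K w}.Finite := by
      refine (Set.finite_range fun c : K.toSubgroup ⧸ K'.toSubgroup.subgroupOf K.toSubgroup =>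
        toSpace.{v} K' (AdelicSpace.mul w c.out.1)).subset fun z hz => ?_
      obtain ⟨c, rfl⟩ := (levelMap_eq_toSpace_iff K K' h z w).1 hz
      exact ⟨c, rfl⟩
    obtain ⟨U, hU, hd⟩ := hfin.t2_separation
    refine ⟨fun y => ⟨U y.1, (hU y.1).2⟩, fun y => (hU y.1).1, fun a b hab => ?_⟩
    have h1 := hd a.2 b.2 (fun e => hab (Subtype.ext e))
    exact disjoint_iff_inf_le.2 fun z hz => Set.disjoint_iff.1 h1 hz

/-- The preimage in 𝒳 of the image is the saturation Z.K of the preimage of Z; this is where the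
stability of Φ under open compact subgroups enters. -/
theorem SupportCondition.level_image (Φ : SupportCondition G Kinf) (K K' : Level G Kinf)
    (hKinf : IsCompact (Kinf : Set (G.points ℝ))) (h : K'.toSubgroup ≤ K.toSubgroup) :
    ∀ Z ∈ (Φ.level.{v} K').sets, levelMap K K' h '' Z ∈ (Φ.level K).sets := fun Z hZ => by
  refine ⟨(isClosedSeparating_levelMap hKinf K K' h).isClosedMap Z hZ.1, ?_⟩
  convert Φ.saturate_mem _ hZ.2 K using 1
  ext x
  simp only [Set.mem_preimage, Set.mem_image, Set.mem_ofPred_eq]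
  constructor
  · rintro ⟨z, hz, hzx⟩
    obtain ⟨c, rfl⟩ := (levelMap_eq_toSpace_iff K K' h z x).1 hzx
    refine ⟨_, hz, c.out.1⁻¹, inv_mem c.out.2, ?_⟩
    rw [← AdelicSpace.mul_mul', mul_inv_cancel, AdelicSpace.mul_one']
  · rintro ⟨z, hz, k, hk, rfl⟩
    exact ⟨_, hz, (toSpace_mul K z hk).symm⟩

/-! ### Local systems and the invertibility of the direct image map. -/

variable {R : Type u} [CommRing R] {GG GG' GG'' : Subgroup (AdelicNat G Kinf)}
variable {M M' M'' : Type v} [AddCommGroup M] [Module R M] [AddCommGroup M'] [Module R M']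
  [AddCommGroup M''] [Module R M'']

/-- Both defining conditions are local on S_K: an orbit of G(ℚ) × K stays over a single V j, and so
do small archimedean displacements. -/
theorem isDisjointAdditive_localSystem (ρ : Representation R (G.points ℚ × GG) M)
    (K : Level G Kinf) (hK : K.toSubgroup ≤ GG) :
    IsDisjointAdditive (localSystem.{u, v} ρ K hK) := by
  intro ι V hV s
  have hmem : ∀ y : {y : AdelicCoset G Kinf // proj.{v} K y ∈ iSup V}, ∃ j, proj K y.1 ∈ V j :=
    fun y => Opens.mem_iSup.1 y.2
  choose j hj using hmem
  have huniq : ∀ (z : space.{v} K) (a b : ι), z ∈ V a → z ∈ V b → a = b := fun z a b ha hb => by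
    by_contra hab
    exact (hV hab).le_bot (show z ∈ V a ⊓ V b from ⟨ha, hb⟩)
  let s' : ∀ a, localSections ρ K hK (V a) := s
  let t : {y : AdelicCoset G Kinf // proj.{v} K y ∈ iSup V} → M := fun y => (s' (j y)).1 ⟨y.1, hj y⟩
  have ht : ∀ y a (ha : proj K y.1 ∈ V a), t y = (s' a).1 ⟨y.1, ha⟩ := by
    intro y a ha
    obtain rfl := huniq _ _ _ (hj y) ha
    rfl
  have htm : t ∈ localSections ρ K hK (iSup V) := by
    refine ⟨fun y y' γ k hk e => ?_, fun y => ?_⟩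
    · have hy' : proj K y'.1 ∈ V (j y) := by
        rw [e, proj_act, proj_mul K _ hk]
        exact hj y
      rw [ht y' _ hy']
      exact (s' (j y)).2.1 ⟨y.1, hj y⟩ ⟨y'.1, hy'⟩ γ k hk e
    · have hc : Continuous fun x => proj.{v} K (x, y.1.2) :=
        (isOpenQuotientMap_proj K).continuous.comp (continuous_id.prodMk continuous_const)
      filter_upwards [(s' (j y)).2.2 ⟨y.1, hj y⟩,
        hc.continuousAt.preimage_mem_nhds ((V (j y)).2.mem_nhds (hj y))] with x hx hxV hxU
      rw [ht ⟨(x, y.1.2), hxU⟩ (j y) hxV]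
      exact hx hxV
  refine ⟨(⟨t, htm⟩ : localSections ρ K hK (iSup V)), fun a => ?_, fun r hr => ?_⟩
  · exact Subtype.ext (funext fun y => ht ⟨y.1, le_iSup V a y.2⟩ a y.2)
  · refine Subtype.ext (funext fun y => ?_)
    exact congrFun (congrArg Subtype.val (hr (j y))) ⟨y.1, hj y⟩

/-- `cohomologyPush` takes the value 0 unless this map is invertible, so every computation with
`pushForward` depends on it. -/
theorem isIso_directImageMap (hKinf : IsCompact (Kinf : Set (G.points ℝ)))
    (Φ : SupportCondition G Kinf) (ρ : Representation R (G.points ℚ × GG) M)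
    (K K' : Level G Kinf) (hK : K.toSubgroup ≤ GG) (h : K'.toSubgroup ≤ K.toSubgroup) (i : ℤ) :
    IsIso (directImageMap (Φ := Φ.level K) (Φ' := Φ.level K') (levelMap.{v} K K' h)
      (Φ.level_preimage K K' h) (localSystem ρ K' (h.trans hK)) i) :=
  isIso_cohomologyMap (isClosedSeparating_levelMap hKinf K K' h)
    (fun _ => Function.bijective_id) (isDisjointAdditive_localSystem ρ K' (h.trans hK)) _
    (Φ.level_image K K' hKinf h) i

/-! ### Traces -/

/-- The trace as a sum over an arbitrary system of representatives. -/
theorem traceFun_eq_sum (ρ : Representation R (G.points ℚ × GG) M) {K K' : Level G Kinf}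
    (hK : K.toSubgroup ≤ GG) (h : K'.toSubgroup ≤ K.toSubgroup) (U : Opens (space.{v} K))
    (f : localSections ρ K' (h.trans hK) ((Opens.map (levelMap K K' h)).obj U))
    (y : {y : AdelicCoset G Kinf // proj K y ∈ U}) {ι : Type*} [Fintype ι]
    (r : ι → K.toSubgroup) (hr : Function.Bijective fun a =>
      (QuotientGroup.mk (r a) : K.toSubgroup ⧸ K'.toSubgroup.subgroupOf K.toSubgroup)) :
    traceFun ρ K K' hK h U f.1 y = ∑ a, ρ (1, ⟨(r a).1, hK (r a).2⟩)
      (f.1 ⟨y.1.mul (r a).1, (proj_mul K y.1 (r a).2 ▸ y.2 : proj K (y.1.mul (r a).1) ∈ U)⟩) := by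
  refine (Fintype.sum_bijective _ hr _ _ fun a => ?_).symm
  have h1 : ((QuotientGroup.mk (r a) : K.toSubgroup ⧸ K'.toSubgroup.subgroupOf
      K.toSubgroup).out)⁻¹ * r a ∈ K'.toSubgroup.subgroupOf K.toSubgroup := by
    rw [← QuotientGroup.eq, QuotientGroup.out_eq']
  have hy : proj K' ((y.1.mul (r a).1).act 1) ∈ (Opens.map (levelMap.{v} K K' h)).obj U := by
    rw [AdelicCoset.act_one]
    exact (proj_mul K y.1 (r a).2 ▸ y.2 : proj K (y.1.mul (r a).1) ∈ U)
  refine Eq.trans ?_ (trace_term ρ hK h U f y (r a) _ 1 h1 hy _)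
  exact congrArg (fun z => ρ (1, ⟨(r a).1, hK (r a).2⟩) (f.1 z))
    (Subtype.ext (AdelicCoset.act_one _).symm)

/-- For a section f that is already equivariant under K, each of the [K : K'] summands k.f(y.k) of
the trace equals f(y). -/
theorem localPull_localTrace (ρ : Representation R (G.points ℚ × GG) M) (K K' : Level G Kinf)
    (hK : K.toSubgroup ≤ GG) (h : K'.toSubgroup ≤ K.toSubgroup) :
    localPull.{u, v} ρ K K' hK h ≫ localTrace ρ K K' hK h =
      K'.toSubgroup.relIndex K.toSubgroup • 𝟙 _ := by
  ext U f
  let f' : localSections ρ K hK U := f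
  have hsum : ∀ y : {y : AdelicCoset G Kinf // proj K y ∈ U},
      traceFun ρ K K' hK h U (fun y => f'.1 ⟨y.1, y.2⟩) y =
        K'.toSubgroup.relIndex K.toSubgroup • f'.1 y := fun y => by
    have hterm : ∀ c : K.toSubgroup ⧸ K'.toSubgroup.subgroupOf K.toSubgroup,
        ρ (1, ⟨c.out.1, hK c.out.2⟩) (f'.1 ⟨y.1.mul c.out.1,
          (proj_mul K y.1 c.out.2 ▸ y.2 : proj K (y.1.mul c.out.1) ∈ U)⟩) = f'.1 y := fun c => by
      rw [f'.2.1 y ⟨y.1.mul c.out.1, _⟩ 1 c.out.1 c.out.2 (AdelicCoset.act_one _).symm,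
        ← Module.End.mul_apply, ← map_mul]
      have e : ((1, ⟨c.out.1, hK c.out.2⟩) * (1, ⟨c.out.1⁻¹, hK (inv_mem c.out.2)⟩) :
          G.points ℚ × GG) = 1 := Prod.ext (one_mul 1) (Subtype.ext (mul_inv_cancel c.out.1))
      rw [e, map_one, Module.End.one_apply]
    refine (Finset.sum_congr rfl fun c _ => hterm c).trans ?_
    rw [Finset.sum_const, Finset.card_univ, Subgroup.relIndex, Subgroup.index,
      Nat.card_eq_fintype_card]
  have e : (K'.toSubgroup.relIndex K.toSubgroup • 𝟙 (localSystem.{u, v} ρ K hK)).app (op U) =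
      K'.toSubgroup.relIndex K.toSubgroup • 𝟙 _ := by
    rw [NatTrans.app_nsmul]
    rfl
  refine Eq.trans (Subtype.ext (funext hsum) : _ = K'.toSubgroup.relIndex K.toSubgroup • f') ?_
  rw [e]
  rfl

/-! ### Relations between pullbacks, translations and push-forwards. -/

theorem toSpace_surjective (K : Level G Kinf) (z : space.{v} K) :
    ∃ x, toSpace.{v} K x = z := (isOpenQuotientMap_toSpace K).surjective z

theorem pullback_translate (Φ : SupportCondition G Kinf)
    (ρ : Representation R (G.points ℚ × GG) M) (ρ' : Representation R (G.points ℚ × GG') M')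
    (φ : M →ₗ[R] M') (t : AdelicNat G Kinf) (hφ : IsRationalEquivariant ρ ρ' φ)
    (ht : IsAdapted ρ ρ' φ t) (hΦ : Φ.StableUnder t) (K K' L : Level G Kinf)
    (hK : K.toSubgroup ≤ GG) (hL : L.toSubgroup ≤ GG') (h : K'.toSubgroup ≤ K.toSubgroup)
    (h' : ∀ k ∈ L.toSubgroup, t⁻¹ * k * t ∈ K'.toSubgroup) (i : ℤ) :
    pullback Φ ρ K K' hK h i ≫ translate Φ ρ ρ' φ t hφ ht hΦ K' L (h.trans hK) hL h' i =
      translate Φ ρ ρ' φ t hφ ht hΦ K L hK hL (fun k hk => h (h' k hk)) i := by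
  have e : translation.{v} K L t (fun k hk => h (h' k hk)) =
      translation K' L t h' ≫ levelMap K K' h := by
    ext z
    obtain ⟨x, rfl⟩ := toSpace_surjective L z
    rfl
  exact cohomologyMap_comp e _ _ _ (fun U s => rfl) i

theorem translate_pullback (Φ : SupportCondition G Kinf)
    (ρ : Representation R (G.points ℚ × GG) M) (ρ' : Representation R (G.points ℚ × GG') M')
    (φ : M →ₗ[R] M') (t : AdelicNat G Kinf) (hφ : IsRationalEquivariant ρ ρ' φ)
    (ht : IsAdapted ρ ρ' φ t) (hΦ : Φ.StableUnder t) (K L L' : Level G Kinf)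
    (hK : K.toSubgroup ≤ GG) (hL : L.toSubgroup ≤ GG') (h : L'.toSubgroup ≤ L.toSubgroup)
    (h' : ∀ k ∈ L.toSubgroup, t⁻¹ * k * t ∈ K.toSubgroup) (i : ℤ) :
    translate Φ ρ ρ' φ t hφ ht hΦ K L hK hL h' i ≫ pullback Φ ρ' L L' hL h i =
      translate Φ ρ ρ' φ t hφ ht hΦ K L' hK (h.trans hL) (fun k hk => h' k (h hk)) i := by
  have e : translation.{v} K L' t (fun k hk => h' k (h hk)) =
      levelMap L L' h ≫ translation K L t h' := by
    ext z
    obtain ⟨x, rfl⟩ := toSpace_surjective L' z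
    rfl
  exact cohomologyMap_comp e _ _ _ (fun U s => rfl) i

/-- Adaptedness of ts is a separate assumption: it concerns every g in the source group with
(ts)g(ts)⁻¹ in the target group, while sgs⁻¹ need not lie in the middle group. -/
theorem translate_translate (Φ : SupportCondition G Kinf)
    (ρ : Representation R (G.points ℚ × GG) M) (ρ' : Representation R (G.points ℚ × GG') M')
    (ρ'' : Representation R (G.points ℚ × GG'') M'')
    (φ : M →ₗ[R] M') (ψ : M' →ₗ[R] M'') (s t : AdelicNat G Kinf)
    (hφ : IsRationalEquivariant ρ ρ' φ) (hψ : IsRationalEquivariant ρ' ρ'' ψ)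
    (hs : IsAdapted ρ ρ' φ s) (ht : IsAdapted ρ' ρ'' ψ t) (hts : IsAdapted ρ ρ'' (ψ ∘ₗ φ) (t * s))
    (hΦs : Φ.StableUnder s) (hΦt : Φ.StableUnder t) (K L N : Level G Kinf)
    (hK : K.toSubgroup ≤ GG) (hL : L.toSubgroup ≤ GG') (hN : N.toSubgroup ≤ GG'')
    (h : ∀ k ∈ L.toSubgroup, s⁻¹ * k * s ∈ K.toSubgroup)
    (h' : ∀ k ∈ N.toSubgroup, t⁻¹ * k * t ∈ L.toSubgroup)
    (h'' : ∀ k ∈ N.toSubgroup, (t * s)⁻¹ * k * (t * s) ∈ K.toSubgroup) (i : ℤ) :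
    translate Φ ρ ρ' φ s hφ hs hΦs K L hK hL h i ≫ translate Φ ρ' ρ'' ψ t hψ ht hΦt L N hL hN h' i =
      translate Φ ρ ρ'' (ψ ∘ₗ φ) (t * s) (hψ.comp hφ) hts (hΦt.mul hΦs) K N hK hN h'' i := by
  have e : translation.{v} K N (t * s) h'' = translation L N t h' ≫ translation K L s h := by
    ext z
    obtain ⟨x, rfl⟩ := toSpace_surjective N z
    exact congrArg (toSpace K) (AdelicSpace.mul_mul' x t s)
  refine cohomologyMap_comp e _ _ _ (fun U f => Subtype.ext (funext fun y => ?_)) i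
  exact congrArg (fun z => ψ (φ (f.1 z))) (Subtype.ext (AdelicCoset.mul_mul' y.1 t s))

theorem translate_pullback_pushForward (hKinf : IsCompact (Kinf : Set (G.points ℝ)))
    (Φ : SupportCondition G Kinf)
    (ρ : Representation R (G.points ℚ × GG) M) (ρ' : Representation R (G.points ℚ × GG') M')
    (φ : M →ₗ[R] M') (t : AdelicNat G Kinf) (hφ : IsRationalEquivariant ρ ρ' φ)
    (ht : IsAdapted ρ ρ' φ t) (hΦ : Φ.StableUnder t) (K L L' : Level G Kinf)
    (hK : K.toSubgroup ≤ GG) (hL : L.toSubgroup ≤ GG') (h : L'.toSubgroup ≤ L.toSubgroup)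
    (h' : ∀ k ∈ L.toSubgroup, t⁻¹ * k * t ∈ K.toSubgroup) (i : ℤ) :
    translate Φ ρ ρ' φ t hφ ht hΦ K L hK hL h' i ≫ pullback Φ ρ' L L' hL h i ≫
        pushForward Φ ρ' L L' hL h i =
      L'.toSubgroup.relIndex L.toSubgroup • translate Φ ρ ρ' φ t hφ ht hΦ K L hK hL h' i :=
  cohomologyMap_comp_map_comp_push _ _ _ _ _ _ _ _ (localPull_localTrace ρ' L L' hL h) i
    (isIso_directImageMap hKinf Φ ρ' L L' hL h i)

/-- Base change. The assumptions `hinj` and `hsurj` say that l ↦ t⁻¹lt induces a bijection L/L' →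
K/K', so the two traces have corresponding terms. -/
theorem pushForward_translate (hKinf : IsCompact (Kinf : Set (G.points ℝ)))
    (Φ : SupportCondition G Kinf)
    (ρ : Representation R (G.points ℚ × GG) M) (ρ' : Representation R (G.points ℚ × GG') M')
    (φ : M →ₗ[R] M') (t : AdelicNat G Kinf) (hφ : IsRationalEquivariant ρ ρ' φ)
    (ht : IsAdapted ρ ρ' φ t) (hΦ : Φ.StableUnder t) (K K' L L' : Level G Kinf)
    (hK : K.toSubgroup ≤ GG) (hL : L.toSubgroup ≤ GG') (hK' : K'.toSubgroup ≤ K.toSubgroup)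
    (hL' : L'.toSubgroup ≤ L.toSubgroup)
    (h : ∀ k ∈ L.toSubgroup, t⁻¹ * k * t ∈ K.toSubgroup)
    (h' : ∀ k ∈ L'.toSubgroup, t⁻¹ * k * t ∈ K'.toSubgroup)
    (hinj : ∀ k ∈ L.toSubgroup, t⁻¹ * k * t ∈ K'.toSubgroup → k ∈ L'.toSubgroup)
    (hsurj : ∀ k ∈ K.toSubgroup, ∃ l ∈ L.toSubgroup, (t⁻¹ * l * t)⁻¹ * k ∈ K'.toSubgroup)
    (i : ℤ) :
    pushForward Φ ρ K K' hK hK' i ≫ translate Φ ρ ρ' φ t hφ ht hΦ K L hK hL h i =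
      translate Φ ρ ρ' φ t hφ ht hΦ K' L' (hK'.trans hK) (hL'.trans hL) h' i ≫
        pushForward Φ ρ' L L' hL hL' i := by
  have e : translation.{v} K' L' t h' ≫ levelMap K K' hK' =
      levelMap L L' hL' ≫ translation K L t h := by
    ext z
    obtain ⟨x, rfl⟩ := toSpace_surjective L' z
    rfl
  refine cohomologyPush_comp_map _ _ _ _ e _ _ _ _ _ _ _ _
    (fun U f => Subtype.ext (funext fun y => ?_)) i
    (isIso_directImageMap hKinf Φ ρ K K' hK hK' i) (isIso_directImageMap hKinf Φ ρ' L L' hL hL' i)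
  -- The trace over K/K' is computed with representatives conjugated from L/L', since φ is only
  -- compatible with the action of elements of this form.
  let r : (L.toSubgroup ⧸ L'.toSubgroup.subgroupOf L.toSubgroup) → K.toSubgroup :=
    fun d => ⟨t⁻¹ * d.out.1 * t, h _ d.out.2⟩
  have hconj : ∀ a b : AdelicNat G Kinf,
      (t⁻¹ * a * t)⁻¹ * (t⁻¹ * b * t) = t⁻¹ * (a⁻¹ * b) * t := fun a b => by group
  have hr : Function.Bijective fun d =>
      (QuotientGroup.mk (r d) : K.toSubgroup ⧸ K'.toSubgroup.subgroupOf K.toSubgroup) := by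
    constructor
    · intro a b hab
      have hab' : (QuotientGroup.mk (r a) : K.toSubgroup ⧸ K'.toSubgroup.subgroupOf K.toSubgroup) =
        QuotientGroup.mk (r b) := hab
      have h1 : (t⁻¹ * a.out.1 * t)⁻¹ * (t⁻¹ * b.out.1 * t) ∈ K'.toSubgroup :=
        by
        have h := QuotientGroup.eq.1 hab'
        exact h
      rw [hconj] at h1
      rw [← QuotientGroup.out_eq' a, ← QuotientGroup.out_eq' b]
      exact QuotientGroup.eq.2 (hinj _ (mul_mem (inv_mem a.out.2) b.out.2) h1)
    · intro c
      obtain ⟨k, rfl⟩ := QuotientGroup.mk_surjective c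
      obtain ⟨l, hl, hlk⟩ := hsurj k.1 k.2
      refine ⟨QuotientGroup.mk ⟨l, hl⟩, QuotientGroup.eq.2 ?_⟩
      have h2 : (QuotientGroup.mk ⟨l, hl⟩ :
          L.toSubgroup ⧸ L'.toSubgroup.subgroupOf L.toSubgroup).out⁻¹ * ⟨l, hl⟩ ∈
            L'.toSubgroup.subgroupOf L.toSubgroup := by
        rw [← QuotientGroup.eq, QuotientGroup.out_eq']
      have h3 := mul_mem (h' _ h2) hlk
      have h4 : ∀ a : AdelicNat G Kinf, t⁻¹ * (a⁻¹ * l) * t * ((t⁻¹ * l * t)⁻¹ * k.1) =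
          (t⁻¹ * a * t)⁻¹ * k.1 := fun a => by group
      exact (congrArg (· ∈ K'.toSubgroup) (h4 _)).mp h3
  refine (congrArg φ (traceFun_eq_sum ρ hK hK' U f ⟨y.1.mul t, y.2⟩ r hr)).trans ?_
  refine (map_sum φ _ _).trans (Finset.sum_congr rfl fun d _ => ?_)
  have hd : t * (t⁻¹ * d.out.1 * t) * t⁻¹ = d.out.1 := by group
  refine (ht _ (hK (h _ d.out.2)) (by rw [hd]; exact hL d.out.2) _).trans ?_
  have h5 : ((1, ⟨t * (t⁻¹ * d.out.1 * t) * t⁻¹, by rw [hd]; exact hL d.out.2⟩) :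
      G.points ℚ × GG') = (1, ⟨d.out.1, hL d.out.2⟩) := Prod.ext rfl (Subtype.ext hd)
  have h6 : (y.1.mul t).mul (t⁻¹ * d.out.1 * t) = (y.1.mul d.out.1).mul t := by
    rw [← AdelicCoset.mul_mul', ← AdelicCoset.mul_mul', mul_assoc t⁻¹, mul_inv_cancel_left]
  refine (congrArg (fun g => ρ' g _) h5).trans ?_
  exact congrArg (fun z => ρ' (1, ⟨d.out.1, hL d.out.2⟩) (φ (f.1 z))) (Subtype.ext h6)

/-- Products of representatives of K/K' and of K'/K'' represent K/K'', so the iterated trace is the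
trace of the composite. -/
theorem pushForward_pushForward (hKinf : IsCompact (Kinf : Set (G.points ℝ)))
    (Φ : SupportCondition G Kinf) (ρ : Representation R (G.points ℚ × GG) M)
    (K K' K'' : Level G Kinf) (hK : K.toSubgroup ≤ GG) (h : K'.toSubgroup ≤ K.toSubgroup)
    (h' : K''.toSubgroup ≤ K'.toSubgroup) (i : ℤ) :
    pushForward Φ ρ K' K'' (h.trans hK) h' i ≫ pushForward Φ ρ K K' hK h i =
      pushForward Φ ρ K K'' hK (h'.trans h) i := by
  have e : levelMap.{v} K K'' (h'.trans h) = levelMap K' K'' h' ≫ levelMap K K' h := by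
    ext z
    obtain ⟨x, rfl⟩ := toSpace_surjective K'' z
    rfl
  refine cohomologyPush_comp _ _ _ e _ _ _ _ _ _
    (fun U f => Subtype.ext (funext fun y => ?_)) i
    (isIso_directImageMap hKinf Φ ρ K K' hK h i)
    (isIso_directImageMap hKinf Φ ρ K' K'' (h.trans hK) h' i)
    (isIso_directImageMap hKinf Φ ρ K K'' hK (h'.trans h) i)
  let r : (K.toSubgroup ⧸ K'.toSubgroup.subgroupOf K.toSubgroup) ×
      (K'.toSubgroup ⧸ K''.toSubgroup.subgroupOf K'.toSubgroup) → K.toSubgroup :=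
    fun c => ⟨c.1.out.1 * c.2.out.1, mul_mem c.1.out.2 (h c.2.out.2)⟩
  have hr : Function.Bijective fun c =>
      (QuotientGroup.mk (r c) : K.toSubgroup ⧸ K''.toSubgroup.subgroupOf K.toSubgroup) := by
    constructor
    · rintro ⟨a, b⟩ ⟨a', b'⟩ hab
      have hab' : (QuotientGroup.mk (r (a, b)) :
          K.toSubgroup ⧸ K''.toSubgroup.subgroupOf K.toSubgroup) =
        QuotientGroup.mk (r (a', b')) := hab
      have h1 : (a.out.1 * b.out.1)⁻¹ * (a'.out.1 * b'.out.1) ∈ K''.toSubgroup :=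
        by
        have h := QuotientGroup.eq.1 hab'
        exact h
      have ha : a = a' := by
        rw [← QuotientGroup.out_eq' a, ← QuotientGroup.out_eq' a']
        refine QuotientGroup.eq.2 ?_
        have h2 := mul_mem (mul_mem b.out.2 (h' h1)) (inv_mem b'.out.2)
        have h3 : b.out.1 * ((a.out.1 * b.out.1)⁻¹ * (a'.out.1 * b'.out.1)) * b'.out.1⁻¹ =
            a.out.1⁻¹ * a'.out.1 := by group
        exact (h3 ▸ h2 : a.out.1⁻¹ * a'.out.1 ∈ K'.toSubgroup)
      subst ha
      refine Prod.ext rfl ?_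
      rw [← QuotientGroup.out_eq' b, ← QuotientGroup.out_eq' b']
      refine QuotientGroup.eq.2 ?_
      have h3 : (a.out.1 * b.out.1)⁻¹ * (a.out.1 * b'.out.1) = b.out.1⁻¹ * b'.out.1 := by group
      exact (h3 ▸ h1 : b.out.1⁻¹ * b'.out.1 ∈ K''.toSubgroup)
    · intro c
      obtain ⟨k, rfl⟩ := QuotientGroup.mk_surjective c
      have h2 : (QuotientGroup.mk k :
          K.toSubgroup ⧸ K'.toSubgroup.subgroupOf K.toSubgroup).out⁻¹ * k ∈
            K'.toSubgroup.subgroupOf K.toSubgroup := by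
        rw [← QuotientGroup.eq, QuotientGroup.out_eq']
      refine ⟨(QuotientGroup.mk k, QuotientGroup.mk ⟨_, h2⟩), QuotientGroup.eq.2 ?_⟩
      have h3 : (QuotientGroup.mk ⟨_, h2⟩ :
          K'.toSubgroup ⧸ K''.toSubgroup.subgroupOf K'.toSubgroup).out⁻¹ * ⟨_, h2⟩ ∈
            K''.toSubgroup.subgroupOf K'.toSubgroup := by
        rw [← QuotientGroup.eq, QuotientGroup.out_eq']
      have h4 : ∀ a b : AdelicNat G Kinf, (a * b)⁻¹ * k.1 = b⁻¹ * (a⁻¹ * k.1) :=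
        fun a b => by group
      exact (congrArg (· ∈ K''.toSubgroup) (h4 _ _)).mpr h3
  refine (traceFun_eq_sum ρ hK (h'.trans h) U f y r hr).trans ?_
  refine (Fintype.sum_prod_type _).trans (Finset.sum_congr rfl fun a _ => ?_)
  refine Eq.trans (Finset.sum_congr rfl fun b _ => ?_)
    (map_sum (ρ (1, ⟨a.out.1, hK a.out.2⟩)) _ _).symm
  have e1 : ((1, ⟨a.out.1 * b.out.1, hK (mul_mem a.out.2 (h b.out.2))⟩) : G.points ℚ × GG) =
      (1, ⟨a.out.1, hK a.out.2⟩) * (1, ⟨b.out.1, hK (h b.out.2)⟩) := Prod.ext (one_mul 1).symm rfl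
  refine (congrArg (fun g => ρ g _) e1).trans ?_
  rw [map_mul, Module.End.mul_apply]
  exact congrArg (fun z => ρ (1, ⟨a.out.1, hK a.out.2⟩) (ρ (1, ⟨b.out.1, hK (h b.out.2)⟩) (f.1 z)))
    (Subtype.ext (AdelicCoset.mul_mul' _ _ _))

/-! ### Composition of Hecke homomorphisms. -/

theorem heckeHom_eq (Φ : SupportCondition G Kinf) (ρ : Representation R (G.points ℚ × GG) M)
    (ρ' : Representation R (G.points ℚ × GG') M') (φ : M →ₗ[R] M') (t : AdelicNat G Kinf)
    (hφ : IsRationalEquivariant ρ ρ' φ) (ht : IsAdapted ρ ρ' φ t) (hΦ : Φ.StableUnder t)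
    (K K' : Level G Kinf) (hK : K.toSubgroup ≤ GG) (hK' : K'.toSubgroup ≤ GG') (i : ℤ) :
    heckeHom Φ ρ ρ' φ t hφ ht hΦ K K' hK hK' i =
      translate Φ ρ ρ' φ t hφ ht hΦ K ((K.conj t).inter K') hK (inf_le_right.trans hK')
        (fun _ hk => Level.mem_conj.1 hk.1) i ≫
      pushForward Φ ρ' K' ((K.conj t).inter K') hK' inf_le_right i :=
  (Category.assoc _ _ _).symm.trans (congrArg
    (fun q => q ≫ pushForward Φ ρ' K' ((K.conj t).inter K') hK' inf_le_right i)
    (pullback_translate Φ ρ ρ' φ t hφ ht hΦ K _ _ hK _ _ _ i))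

/-- The diagram chase of the main theorem. The pairs (a, p), (b, q) and (c, w) are the translation
and push-forward of ρ_s, ρ_t and ρ_{ts}; b' and p' are the exchanged middle maps through E; u and v
are pullback and push-forward between B' and E. -/
theorem comp_eq_nsmul {C : Type*} [Category C] [Preadditive C] {X₁ X₂ X₃ B D E B' : C}
    {a : X₁ ⟶ B} {p : B ⟶ X₂} {b : X₂ ⟶ D} {q : D ⟶ X₃} {b' : B ⟶ E} {p' : E ⟶ D} {r : E ⟶ X₃}
    {c' : X₁ ⟶ E} {c : X₁ ⟶ B'} {u : B' ⟶ E} {v : E ⟶ B'} {w : B' ⟶ X₃} {m : ℕ}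
    (h₁ : p ≫ b = b' ≫ p') (h₂ : p' ≫ q = r) (h₃ : a ≫ b' = c') (h₄ : c ≫ u = c')
    (h₅ : v ≫ w = r) (h₆ : c ≫ u ≫ v = m • c) : (a ≫ p) ≫ b ≫ q = m • c ≫ w := by
  rw [Category.assoc, ← Category.assoc p, h₁, Category.assoc, h₂, ← Category.assoc, h₃, ← h₄, ← h₅,
    Category.assoc, ← Category.assoc u, ← Category.assoc c, h₆, Preadditive.nsmul_comp]

theorem relIndex_conj (K K' : Subgroup (AdelicNat G Kinf)) (t : AdelicNat G Kinf) :
    (K.map (MulAut.conj t).toMonoidHom).relIndex (K'.map (MulAut.conj t).toMonoidHom) =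
      K.relIndex K' :=
  Subgroup.relIndex_map_map_of_injective _ _ (MulAut.conj t).injective

end AdelicGroup
end

theorem mainTheorem6 {n : ℕ} (G : LinearAlgebraicGroup n) (hG : G.IsConnectedReductive)
    (Kinf : Subgroup (G.points ℝ))
    (hKinf : Maximal (fun H : Subgroup (G.points ℝ) => IsCompact (H : Set (G.points ℝ))) Kinf)
    (Φ : SupportCondition G Kinf)
    {R : Type u} [CommRing R]
    (K₁ K₂ K₃ : Level G Kinf) (hK₁ : K₁.Neat) (hK₂ : K₂.Neat) (hK₃ : K₃.Neat)
    {M₁ M₂ M₃ : Type v} [AddCommGroup M₁] [Module R M₁] [AddCommGroup M₂] [Module R M₂]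
    [AddCommGroup M₃] [Module R M₃]
    (ρ₁ : Representation R (G.points ℚ × K₁.toSubgroup) M₁)
    (ρ₂ : Representation R (G.points ℚ × K₂.toSubgroup) M₂)
    (ρ₃ : Representation R (G.points ℚ × K₃.toSubgroup) M₃)
    (s t : AdelicNat G Kinf) (φ₁ : M₁ →ₗ[R] M₂) (φ₂ : M₂ →ₗ[R] M₃)
    (hφ₁ : IsRationalEquivariant ρ₁ ρ₂ φ₁) (hφ₂ : IsRationalEquivariant ρ₂ ρ₃ φ₂)
    (hs : IsAdapted ρ₁ ρ₂ φ₁ s) (ht : IsAdapted ρ₂ ρ₃ φ₂ t)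
    (hts : IsAdapted ρ₁ ρ₃ (φ₂ ∘ₗ φ₁) (t * s))
    (hΦs : Φ.StableUnder s) (hΦt : Φ.StableUnder t)
    (hK : (K₂.toSubgroup : Set (AdelicNat G Kinf)) =
      (((K₁.conj s).toSubgroup ⊓ K₂.toSubgroup : Subgroup (AdelicNat G Kinf)) :
          Set (AdelicNat G Kinf)) *
        ((K₂.toSubgroup ⊓ (K₃.conj t⁻¹).toSubgroup : Subgroup (AdelicNat G Kinf)) :
          Set (AdelicNat G Kinf)))
    (i : ℤ) :
    heckeHom Φ ρ₁ ρ₂ φ₁ s hφ₁ hs hΦs K₁ K₂ le_rfl le_rfl i ≫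
        heckeHom Φ ρ₂ ρ₃ φ₂ t hφ₂ ht hΦt K₂ K₃ le_rfl le_rfl i =
      ((K₁.conj s).toSubgroup ⊓ K₂.toSubgroup ⊓ (K₃.conj t⁻¹).toSubgroup).relIndex
          ((K₁.conj s).toSubgroup ⊓ (K₃.conj t⁻¹).toSubgroup) •
        heckeHom Φ ρ₁ ρ₃ (φ₂ ∘ₗ φ₁) (t * s) (hφ₂.comp hφ₁) hts (hΦt.mul hΦs)
          K₁ K₃ le_rfl le_rfl i := by
  have hcpt : IsCompact (Kinf : Set (G.points ℝ)) := hKinf.1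
  have hmem : ∀ x : AdelicNat G Kinf, t * (t⁻¹ * x * t) * t⁻¹ = x := fun x => by group
  have hmem' : ∀ x : AdelicNat G Kinf, (t * s)⁻¹ * x * (t * s) = s⁻¹ * (t⁻¹ * x * t) * s :=
    fun x => by group
  have hmem'' : ∀ x : AdelicNat G Kinf, t⁻¹⁻¹ * (t⁻¹ * x * t) * t⁻¹ = x := fun x => by group
  let B : Level G Kinf := (K₁.conj s).inter K₂
  let D : Level G Kinf := (K₂.conj t).inter K₃
  let B' : Level G Kinf := (K₁.conj (t * s)).inter K₃
  -- As B ⊆ K₂, this is tsK₁(ts)⁻¹ ∩ tK₂t⁻¹ ∩ K₃, the level at which both steps of the composite are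
  -- defined.
  let E : Level G Kinf := (B.conj t).inter D
  have hEB : E.toSubgroup ≤ B'.toSubgroup := fun x hx => ⟨Level.mem_conj.2 (by
    rw [hmem']
    exact Level.mem_conj.1 (Level.mem_conj.1 hx.1).1), hx.2.2⟩
  have hEts : ∀ k ∈ E.toSubgroup, (t * s)⁻¹ * k * (t * s) ∈ K₁.toSubgroup :=
    fun k hk => Level.mem_conj.1 (hEB hk).1
  have hidx : E.toSubgroup.relIndex B'.toSubgroup =
      ((K₁.conj s).toSubgroup ⊓ K₂.toSubgroup ⊓ (K₃.conj t⁻¹).toSubgroup).relIndex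
          ((K₁.conj s).toSubgroup ⊓ (K₃.conj t⁻¹).toSubgroup) := by
    -- Conjugation by t carries the two groups of the stated index to E and B'.
    refine Eq.trans ?_ (relIndex_conj _ _ t)
    have hconj : ∀ (H : Subgroup (AdelicNat G Kinf)) (x : AdelicNat G Kinf),
        x ∈ H.map (MulAut.conj t).toMonoidHom ↔ t⁻¹ * x * t ∈ H := fun H x => by
      constructor
      · rintro ⟨y, hy, rfl⟩
        simpa [mul_assoc] using hy
      · exact fun hx => ⟨_, hx, hmem x⟩
    have h3 : ∀ x, t⁻¹ * x * t ∈ (K₃.conj t⁻¹).toSubgroup ↔ x ∈ K₃.toSubgroup := fun x => by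
      rw [Level.mem_conj, hmem'']
    congr 1
    · ext x
      rw [hconj]
      constructor
      · exact fun hx => ⟨Level.mem_conj.1 hx.1, (h3 x).2 hx.2.2⟩
      · exact fun hx => ⟨Level.mem_conj.2 hx.1, Level.mem_conj.2 hx.1.2, (h3 x).1 hx.2⟩
    · ext x
      rw [hconj]
      constructor
      · exact fun hx => ⟨Level.mem_conj.2 (
          (congrArg (· ∈ K₁.toSubgroup) (hmem' x)).mp (Level.mem_conj.1 hx.1)), (h3 x).2 hx.2⟩
      · exact fun hx => ⟨Level.mem_conj.2 (
          (congrArg (· ∈ K₁.toSubgroup) (hmem' x)).mpr (Level.mem_conj.1 hx.1)),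
          (h3 x).1 hx.2⟩
  have hsurj : ∀ k ∈ K₂.toSubgroup, ∃ l ∈ D.toSubgroup, (t⁻¹ * l * t)⁻¹ * k ∈ B.toSubgroup := by
    intro k hk
    -- The hypothesis has the factor from B on the left, whereas cosets kB need it on the right.
    -- Factoring k⁻¹ = bc gives k = c⁻¹b⁻¹, and l = tc⁻¹t⁻¹ is the required element of D.
    have h1 : k⁻¹ ∈ (K₂.toSubgroup : Set (AdelicNat G Kinf)) := inv_mem hk
    rw [hK] at h1
    obtain ⟨b, hb, c, hc, hbc⟩ := Set.mem_mul.1 h1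
    have hb' : b⁻¹ ∈ B.toSubgroup := B.toSubgroup.inv_mem hb
    have hc1 : c⁻¹ ∈ K₂.toSubgroup := K₂.toSubgroup.inv_mem hc.1
    have hc2 : (t⁻¹⁻¹ * c * t⁻¹)⁻¹ ∈ K₃.toSubgroup := inv_mem (Level.mem_conj.1 hc.2)
    have e₁ : (t⁻¹ * (t * c⁻¹ * t⁻¹) * t)⁻¹ * k = b⁻¹ := by
      rw [← inv_inv k, ← hbc]
      group
    have e₂ : t⁻¹ * (t * c⁻¹ * t⁻¹) * t = c⁻¹ := by group
    have e₃ : (t⁻¹⁻¹ * c * t⁻¹)⁻¹ = t * c⁻¹ * t⁻¹ := by group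
    rw [← e₁] at hb'
    rw [← e₂] at hc1
    rw [e₃] at hc2
    exact ⟨t * c⁻¹ * t⁻¹, ⟨Level.mem_conj.2 hc1, hc2⟩, hb'⟩
  rw [heckeHom_eq, heckeHom_eq, heckeHom_eq, ← hidx]
  exact comp_eq_nsmul
    (pushForward_translate hcpt Φ ρ₂ ρ₃ φ₂ t hφ₂ ht hΦt K₂ B D E le_rfl inf_le_right inf_le_right
      inf_le_right (fun k hk => Level.mem_conj.1 hk.1) (fun k hk => Level.mem_conj.1 hk.1)
      (fun k hk hk' => ⟨Level.mem_conj.2 hk', hk⟩) hsurj i)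
    (pushForward_pushForward hcpt Φ ρ₃ K₃ D E le_rfl inf_le_right inf_le_right i)
    (translate_translate Φ ρ₁ ρ₂ ρ₃ φ₁ φ₂ s t hφ₁ hφ₂ hs ht hts hΦs hΦt K₁ B E _ _ _ _ _ hEts i)
    (translate_pullback Φ ρ₁ ρ₃ (φ₂ ∘ₗ φ₁) (t * s) (hφ₂.comp hφ₁) hts (hΦt.mul hΦs) K₁ B' E
      le_rfl inf_le_right hEB (fun _ hk => Level.mem_conj.1 hk.1) i)
    (pushForward_pushForward hcpt Φ ρ₃ K₃ B' E le_rfl inf_le_right hEB i)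
    (translate_pullback_pushForward hcpt Φ ρ₁ ρ₃ (φ₂ ∘ₗ φ₁) (t * s) (hφ₂.comp hφ₁) hts
      (hΦt.mul hΦs) K₁ B' E le_rfl inf_le_right hEB (fun _ hk => Level.mem_conj.1 hk.1) i)
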